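/- Let $\mathbb K\in\{\mathbb R,\mathbb C\}$, let $A\in\mathbb K^{N\times n}$ have rows $a_1,\dots,a_N$, let $0\ne w\in\mathbb K^n$, and write $\langle u,v\rangle=\sum_i u_iv_i$. Let $b=Ax+\varepsilon$, where $x\in\mathbb K^n$ is an unknown parameter and the noise $\varepsilon$ is a centered multivariate Gaussian vector in $\mathbb K^N$ (circularly symmetric if $\mathbb K=\mathbb C$), possibly degenerate, with covariance matrix $\Sigma=\mathbb E(\bar\varepsilon\,\varepsilon^\top)$. *Circuits and divisors.* A set $C\subseteq[N]$ is a *particular circuit* if $w=\sum_{i\in C}\lambda_ia_i$ has a solution and every solution has all $\lambda_i\neq0$; it is a *general circuit* if $0=\sum_{i\in C}\lambda_ia_i$ has a nonzero solution and every nonzero solution has all $\lambda_i\ne0$. Its circuit vector $\lambda_C\in\mathbb K^N$ is the solution, extended by zero (unique in the particular case; a fixed solution of norm one in the general case). A *divisor* is a formal $\mathbb K$-linear combination $D=\sum_j\alpha_jC_j$ of circuits, with vector $\lambda_D=\sum_j\alpha_j\lambda_{C_j}$; $D\sim D'$ means $\lambda_D=\lambda_{D'}$. For $I\subseteq[N]$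 let $\mathcal L(I)$ be the set of all $D\sim C+D'$ with $C\subseteq I$ a particular circuit and $D'$ a linear combination of general circuits contained in $I$. A *particular system* is a nonempty affine space $\mathcal L\subseteq\mathcal L([N])$ of divisors that is closed under $\sim$. A *support* $\operatorname{supp}\mathcal L$ of $\mathcal L$ is an inclusion-maximal set $I\subseteq[N]$ with $\mathcal L(I)\subseteq\mathcal L$. *Theorem.* Let $\mathcal L$ be a particular system with support $I=\operatorname{supp}\mathcal L$. Then the quadratic form $k(D,D)=\lambda_D^*\Sigma\lambda_D$ attains its minimum on $\mathcal L$. Let $D\in\mathcal L$ be any minimizer and $\widehat\gamma(\mathcal L)=\langle\lambda_D,b\rangle$, and suppose that $\widehat\gamma(\mathcal L)$ is a function of the observations $b_I=(b_i)_{i\in I}$, that is, $\lambda_D$ vanishes outside $I$ (as is always the case when $\mathcal L=\mathcal L(I)$). Then, for the family of laws of $b_I$ indexed by $x\in\mathbb K^n$: 1. $\widehat\gamma(\mathcal L)$ is a complete statistic: if $g$ is measurable and $\mathbb E_x\,g(\widehat\gamma(\mathcal L))$ exists and is $0$ for all $x$, then $g(\widehat\gamma(\mathcal L))=0$ almost surely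 for all $x$. 2. $\widehat\gamma(\mathcal L)$ is a sufficient statistic for the parameter $\langle w,x\rangle$, the remaining part of $x$ being a nuisance parameter (Fraser's sufficiency, or S-sufficiency): the law of $\widehat\gamma(\mathcal L)$ depends on $x$ only through $\langle w,x\rangle$, and there is a linear map $\eta:\mathbb K^n\to\ker\langle w,\cdot\rangle$ such that $x\mapsto(\langle w,x\rangle,\eta(x))$ is a bijection onto $\mathbb K\times\ker\langle w,\cdot\rangle$ and, for each fixed value of $\eta(x)$, the conditional law of $b_I$ given $\widehat\gamma(\mathcal L)$ does not depend on $\langle w,x\rangle$. 3. $\widehat\gamma(\mathcal L)$ is the minimum variance unbiased estimator of $\langle w,x\rangle$ from $b_I$: it is unbiased, for every $x$ its variance is at most that of any estimator $U(b_I)$ that is unbiased for all $x$, and any other minimum variance unbiased estimator is almost surely equal to it, for every $x$. -/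

import Mathlib

open MeasureTheory ProbabilityTheory
open scoped Matrix ENNReal

noncomputable section

namespace MatroidRegression

/-! ### Regression circuits and circuit divisors -/

section Circuits

variable {𝕜 : Type*} [RCLike 𝕜] {N n : ℕ}

/-- `C` is a particular regression circuit: `w = ∑ i ∈ C, l i • a i` is solvable, and every
solution has all its coefficients on `C` nonzero. Here `a i` is the `i`-th row of `A`. -/
def IsParticularCircuit (A : Matrix (Fin N) (Fin n) 𝕜) (w : Fin n → 𝕜)
    (C : Finset (Fin N)) : Prop :=
  (∃ l : Fin N → 𝕜, (∀ i ∉ C, l i = 0) ∧ l ᵥ* A = w) ∧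
    ∀ l : Fin N → 𝕜, (∀ i ∉ C, l i = 0) → l ᵥ* A = w → ∀ i ∈ C, l i ≠ 0

/-- `C` is a general regression circuit: the rows indexed by `C` have a nontrivial linear
relation, and every nontrivial relation has all its coefficients on `C` nonzero. -/
def IsGeneralCircuit (A : Matrix (Fin N) (Fin n) 𝕜) (C : Finset (Fin N)) : Prop :=
  (∃ l : Fin N → 𝕜, l ≠ 0 ∧ (∀ i ∉ C, l i = 0) ∧ l ᵥ* A = 0) ∧
    ∀ l : Fin N → 𝕜, l ≠ 0 → (∀ i ∉ C, l i = 0) → l ᵥ* A = 0 → ∀ i ∈ C, l i ≠ 0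

/-- The circuits, of either type, of the regression matroid of `A` and `w`. -/
def Circuit (A : Matrix (Fin N) (Fin n) 𝕜) (w : Fin n → 𝕜) : Type :=
  {C : Finset (Fin N) // IsParticularCircuit A w C ∨ IsGeneralCircuit A C}

/-- `l` represents the circuit `C`: the solution of `l A = w` on `C` if `C` is particular,
a normed solution of `l A = 0` on `C` if `C` is general. -/
def IsCircuitVector (A : Matrix (Fin N) (Fin n) 𝕜) (w : Fin n → 𝕜)
    (C : Finset (Fin N)) (l : Fin N → 𝕜) : Prop :=
  (∀ i ∉ C, l i = 0) ∧
    ((IsParticularCircuit A w C ∧ l ᵥ* A = w) ∨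
      (IsGeneralCircuit A C ∧ l ᵥ* A = 0 ∧ ∑ i, ‖l i‖ ^ 2 = 1))

theorem exists_isCircuitVector {A : Matrix (Fin N) (Fin n) 𝕜} {w : Fin n → 𝕜}
    (C : Circuit A w) : ∃ l, IsCircuitVector A w C.1 l := by
  rcases C.2 with h | h
  · obtain ⟨l, h0, h1⟩ := h.1
    exact ⟨l, h0, Or.inl ⟨h, h1⟩⟩
  · obtain ⟨l, hne, h0, h1⟩ := h.1
    have hpos : 0 < ∑ i, ‖l i‖ ^ 2 := by
      obtain ⟨i, hi⟩ := Function.ne_iff.mp hne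
      have hi' : 0 < ‖l i‖ := norm_pos_iff.mpr hi
      exact Finset.sum_pos' (fun j _ => by positivity) ⟨i, Finset.mem_univ i, by positivity⟩
    refine ⟨((((Real.sqrt (∑ i, ‖l i‖ ^ 2))⁻¹ : ℝ) : 𝕜)) • l, ?_, Or.inr ⟨h, ?_, ?_⟩⟩
    · intro i hi
      simp [h0 i hi]
    · rw [Matrix.smul_vecMul, h1, smul_zero]
    · simp only [Pi.smul_apply, smul_eq_mul, norm_mul, mul_pow, ← Finset.mul_sum,
        RCLike.norm_ofReal, sq_abs, inv_pow]
      rw [Real.sq_sqrt hpos.le]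
      exact inv_mul_cancel₀ hpos.ne'

/-- The circuit vector of a circuit (unique for a particular circuit). -/
def circuitVector {A : Matrix (Fin N) (Fin n) 𝕜} {w : Fin n → 𝕜} (C : Circuit A w) :
    Fin N → 𝕜 :=
  Classical.choose (exists_isCircuitVector C)

/-- Circuit divisors: formal linear combinations of circuits. -/
abbrev Divisor (A : Matrix (Fin N) (Fin n) 𝕜) (w : Fin n → 𝕜) : Type _ :=
  Circuit A w →₀ 𝕜

/-- The circuit vector of a circuit divisor. -/
def divisorVector {A : Matrix (Fin N) (Fin n) 𝕜} {w : Fin n → 𝕜} :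
    Divisor A w →ₗ[𝕜] (Fin N → 𝕜) :=
  Finsupp.linearCombination 𝕜 circuitVector

/-- Linear equivalence of divisors: equality of circuit vectors. -/
def LinEquivalent {A : Matrix (Fin N) (Fin n) 𝕜} {w : Fin n → 𝕜} (D₁ D₂ : Divisor A w) : Prop :=
  divisorVector D₁ = divisorVector D₂

/-- The span of the general circuits contained in `I`. -/
def generalSystemOn (A : Matrix (Fin N) (Fin n) 𝕜) (w : Fin n → 𝕜) (I : Finset (Fin N)) :
    Submodule 𝕜 (Divisor A w) :=
  Submodule.span 𝕜
    {D | ∃ C : Circuit A w, IsGeneralCircuit A C.1 ∧ C.1 ⊆ I ∧ D = Finsupp.single C 1}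

/-- The particular system `𝓛(I)`: all divisors linearly equivalent to the sum of a particular
circuit contained in `I` and a general divisor on general circuits contained in `I`. -/
def particularSystemOn (A : Matrix (Fin N) (Fin n) 𝕜) (w : Fin n → 𝕜) (I : Finset (Fin N)) :
    Set (Divisor A w) :=
  {D | ∃ C : Circuit A w, IsParticularCircuit A w C.1 ∧ C.1 ⊆ I ∧
    ∃ D' ∈ generalSystemOn A w I, LinEquivalent D (Finsupp.single C 1 + D')}

/-- The regression space, whose elements are the particular regression divisors. -/
def regressionSpace (A : Matrix (Fin N) (Fin n) 𝕜) (w : Fin n → 𝕜) : Set (Divisor A w) :=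
  particularSystemOn A w Finset.univ

/-- Particular systems: (nonempty) affine spaces of particular regression divisors, closed under
linear equivalence. -/
structure IsParticularSystem {A : Matrix (Fin N) (Fin n) 𝕜} {w : Fin n → 𝕜}
    (L : AffineSubspace 𝕜 (Divisor A w)) : Prop where
  nonempty : (L : Set (Divisor A w)).Nonempty
  subset : (L : Set (Divisor A w)) ⊆ regressionSpace A w
  closed : ∀ D₁ ∈ L, ∀ D₂, LinEquivalent D₁ D₂ → D₂ ∈ L

/-- `I` is a support of the particular system `L`: an inclusion-wise maximal set of rows such that
`L` contains `𝓛(I)`. -/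
def IsSupport {A : Matrix (Fin N) (Fin n) 𝕜} {w : Fin n → 𝕜}
    (L : AffineSubspace 𝕜 (Divisor A w)) (I : Finset (Fin N)) : Prop :=
  Maximal (fun J : Finset (Fin N) => particularSystemOn A w J ⊆ (L : Set (Divisor A w))) I

end Circuits

/-! ### Noise, circuit kernel, and the estimator -/

section Estimator

variable {𝕜 : Type*} [RCLike 𝕜] {N n : ℕ}

/-- Centered multivariate Gaussian law on `𝕜 ^ N`. For `𝕜 = ℝ` the last field is void; for `𝕜 = ℂ`
(where `RCLike.I ≠ 0`) it says that the pseudo-covariance vanishes, i.e. that the law is a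
circularly symmetric complex Gaussian. -/
structure IsGaussianNoise (μ : Measure (Fin N → 𝕜)) : Prop where
  gaussian : IsGaussian μ
  centered : ∀ i, ∫ e, e i ∂μ = 0
  circular : (RCLike.I : 𝕜) ≠ 0 → ∀ i j, ∫ e, e i * e j ∂μ = 0

/-- Covariance matrix of centered noise, with the conjugate on the first factor, so that
`l* Σ l` is the variance of the evaluation `∑ i, l i * ε i`. -/
def noiseCov (μ : Measure (Fin N → 𝕜)) : Matrix (Fin N) (Fin N) 𝕜 :=
  Matrix.of fun i j => ∫ e, star (e i) * e j ∂μ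

/-- The circuit kernel `k(D₁, D₂) = λ₁* Σ λ₂`. -/
def circuitKernel {A : Matrix (Fin N) (Fin n) 𝕜} {w : Fin n → 𝕜}
    (S : Matrix (Fin N) (Fin N) 𝕜) (D₁ D₂ : Divisor A w) : 𝕜 :=
  star (divisorVector D₁) ⬝ᵥ (S *ᵥ divisorVector D₂)

/-- `D` minimizes `k(D, D)` over `L`. -/
def IsKernelMinimizer {A : Matrix (Fin N) (Fin n) 𝕜} {w : Fin n → 𝕜}
    (S : Matrix (Fin N) (Fin N) 𝕜) (L : AffineSubspace 𝕜 (Divisor A w)) (D : Divisor A w) : Prop :=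
  D ∈ L ∧ ∀ D' ∈ L, RCLike.re (circuitKernel S D D) ≤ RCLike.re (circuitKernel S D' D')

/-- The law of the observations `(b i)`, `i ∈ I`, where `b = A x + ε` and `ε` has law `μ`. -/
def observationLaw (A : Matrix (Fin N) (Fin n) 𝕜) (μ : Measure (Fin N → 𝕜)) (I : Finset (Fin N))
    (x : Fin n → 𝕜) : Measure (I → 𝕜) :=
  μ.map fun e i => (A *ᵥ x + e) i

/-- The estimator `∑ i ∈ I, λ_D i * b i` as a function of the observations indexed by `I`; it is
`⟨λ_D, b⟩` as soon as `λ_D` vanishes outside `I`. -/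
def estimator {A : Matrix (Fin N) (Fin n) 𝕜} {w : Fin n → 𝕜} (I : Finset (Fin N))
    (D : Divisor A w) (b : I → 𝕜) : 𝕜 :=
  ∑ i : I, divisorVector D i * b i

/-- The parameter of interest, `x ↦ ⟨w, x⟩ = ∑ j, w j * x j`. -/
def target (w : Fin n → 𝕜) : (Fin n → 𝕜) →ₗ[𝕜] 𝕜 :=
  dotProductBilin 𝕜 𝕜 w

end Estimator

/-! ### Statistics -/

section Statistics

variable {Θ Y Z : Type*} [MeasurableSpace Y] [MeasurableSpace Z]

/-- `T` is a complete statistic for the family `P`: a measurable function of `T` whose expectation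
vanishes under every member of the family is almost surely zero under every member. -/
def IsCompleteStatistic (𝕜 : Type*) [RCLike 𝕜] (P : Θ → Measure Y) (T : Y → Z) : Prop :=
  ∀ g : Z → 𝕜, Measurable g → (∀ θ, Integrable (fun y => g (T y)) (P θ)) →
    (∀ θ, ∫ y, g (T y) ∂(P θ) = 0) → ∀ θ, ∀ᵐ y ∂(P θ), g (T y) = 0

/-- `T` is a sufficient statistic for the family `P`: the conditional law of the observation given
`T` can be chosen the same for all members of the family. -/
def IsSufficientStatistic (P : Θ → Measure Y) (T : Y → Z) : Prop :=
  ∃ κ : Kernel Z Y, IsMarkovKernel κ ∧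
    ∀ θ, (P θ).map (fun y => (T y, y)) = ((P θ).map T) ⊗ₘ κ

/-- `T` is sufficient for the parameter of interest `ψ`, the rest of the parameter `x` being a
nuisance (Fraser's sufficiency, also called S-sufficiency): the law of `T` depends on `x` only
through `ψ x`, and there is a nuisance parameter `η`, such that `(ψ, η)` is a linear
reparametrization by a full product, for which the conditional law of the observation given `T`
depends on `x` only through `η x`; that is, for each fixed value of `η`, the statistic `T` is
sufficient in the ordinary sense. -/
def IsSufficientFor {𝕜 E : Type*} [RCLike 𝕜] [AddCommGroup E] [Module 𝕜 E]
    (P : E → Measure Y) (ψ : E →ₗ[𝕜] 𝕜) (T : Y → Z) : Prop :=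
  (∀ x x', ψ x = ψ x' → (P x).map T = (P x').map T) ∧
    ∃ η : E →ₗ[𝕜] LinearMap.ker ψ,
      Function.Bijective (fun x => (ψ x, η x)) ∧
        ∀ h, IsSufficientStatistic (fun x : {x : E // η x = h} => P x) T

variable {𝕜 : Type*} [RCLike 𝕜]

/-- `U` is an unbiased estimator of `g`. -/
def IsUnbiased (P : Θ → Measure Y) (g : Θ → 𝕜) (U : Y → 𝕜) : Prop :=
  Measurable U ∧ ∀ θ, Integrable U (P θ) ∧ ∫ y, U y ∂(P θ) = g θ

/-- The variance `E |U - E U|²`, possibly infinite. -/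
def eVar (U : Y → 𝕜) (ν : Measure Y) : ℝ≥0∞ :=
  ∫⁻ y, ‖U y - ∫ z, U z ∂ν‖ₑ ^ 2 ∂ν

/-- `U` is a (uniformly) minimum variance unbiased estimator of `g`. -/
def IsMVUE (P : Θ → Measure Y) (g : Θ → 𝕜) (U : Y → 𝕜) : Prop :=
  IsUnbiased P g U ∧ ∀ U', IsUnbiased P g U' → ∀ θ, eVar U (P θ) ≤ eVar U' (P θ)

end Statistics

end MatroidRegression

end

open MatroidRegression

/-!
A minimizer `λ_D` of the variance over `𝓛` is `Σ`-orthogonal to the relations between the rows of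
`A` with indices in `I`, because `𝓛(I) ⊆ 𝓛`. Hence on `I` the covariance vector `λ_D* Σ` is a
multiple of a signal `A v` with `⟨w, v⟩ = 1`. Therefore `b_I` splits into `γ̂ • (A v)_I` and a
residual which is uncorrelated with `γ̂`, thus independent of it, and whose law only depends on the
component of `x` in `ker ⟨w, ·⟩` along `v`: this is S-sufficiency. The laws of `γ̂` form a Gaussian
location family. Translating a centered Gaussian law by a vector of its Cameron–Martin space amounts
to exponential tilting, so that completeness is the injectivity of the Laplace transform. For a
fixed nuisance component `γ̂` is complete and sufficient, and Lehmann–Scheffé gives minimality of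
the variance.
-/

namespace MatroidRegression

open scoped ComplexOrder NNReal

section LinearRelations

variable {R ι κ : Type*}

theorem exists_subset_minimal_support [Zero R] {p : (ι → R) → Prop} {I : Finset ι} {l : ι → R}
    (hl : p l) (hlI : ∀ i ∉ I, l i = 0) :
    ∃ C ⊆ I, (∃ l, p l ∧ ∀ i ∉ C, l i = 0) ∧
      ∀ l, p l → (∀ i ∉ C, l i = 0) → ∀ i ∈ C, l i ≠ 0 := by
  classical
  obtain ⟨C, hCI, hC⟩ := exists_minimal_le_of_wellFoundedLT
    (fun C : Finset ι => ∃ l, p l ∧ ∀ i ∉ C, l i = 0) I ⟨l, hl, hlI⟩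
  refine ⟨C, hCI, hC.prop, fun l hl hlC i hi hli => ?_⟩
  have hl_erase : ∀ j ∉ C.erase i, l j = 0 := fun j hj => by
    by_cases hji : j = i
    · rwa [hji]
    · exact hlC j fun hjC => hj (Finset.mem_erase.mpr ⟨hji, hjC⟩)
  exact Finset.notMem_erase i C (hC.le_of_le ⟨l, hl, hl_erase⟩ (Finset.erase_subset i C) hi)

theorem sub_div_smul_apply_of_notMem_erase [Field R] [DecidableEq ι] {I : Finset ι}
    {z u : ι → R} (hz : ∀ i ∉ I, z i = 0) (hu : ∀ i ∉ I, u i = 0) {i : ι} (hi : u i ≠ 0) :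
    ∀ j ∉ I.erase i, (z - (z i / u i) • u) j = 0 := by
  intro j hj
  by_cases hji : j = i
  · simp [hji, hi]
  · have hjI : j ∉ I := fun hjI => hj (Finset.mem_erase.mpr ⟨hji, hjI⟩)
    simp [hz j hjI, hu j hjI]

variable [CommRing R] [Fintype ι]

/-- The linear relations between the rows of `A` with indices in `I`, as coefficient vectors
extended by zero. -/
def relationsOn (A : Matrix ι κ R) (I : Finset ι) : Submodule R (ι → R) where
  carrier := {z | (∀ i ∉ I, z i = 0) ∧ z ᵥ* A = 0}
  zero_mem' := by simp
  add_mem' := by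
    rintro y z ⟨hy, hyA⟩ ⟨hz, hzA⟩
    exact ⟨fun i hi => by simp [hy i hi, hz i hi], by rw [Matrix.add_vecMul, hyA, hzA, add_zero]⟩
  smul_mem' := by
    rintro a z ⟨hz, hzA⟩
    exact ⟨fun i hi => by simp [hz i hi], by rw [Matrix.smul_vecMul, hzA, smul_zero]⟩

/-- The representations of `w` as a combination of the rows of `A` with indices in `I`, as
coefficient vectors extended by zero. -/
def representationsOn (A : Matrix ι κ R) (w : κ → R) (I : Finset ι) : Set (ι → R) :=
  {l | (∀ i ∉ I, l i = 0) ∧ l ᵥ* A = w}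

theorem mem_representationsOn_iff_sub_mem_relationsOn {A : Matrix ι κ R} {w : κ → R}
    {I : Finset ι} {l l₀ : ι → R} (h₀ : l₀ ∈ representationsOn A w I) :
    l ∈ representationsOn A w I ↔ l - l₀ ∈ relationsOn A I := by
  refine and_congr (forall₂_congr fun i hi => ?_) ?_
  · simp [h₀.1 i hi]
  · rw [Matrix.sub_vecMul, h₀.2, sub_eq_zero]

end LinearRelations

section CircuitVectors

variable {𝕜 : Type*} [RCLike 𝕜] {N n : ℕ} {A : Matrix (Fin N) (Fin n) 𝕜} {w : Fin n → 𝕜}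
  {I : Finset (Fin N)}

theorem exists_isParticularCircuit_subset (h : (representationsOn A w I).Nonempty) :
    ∃ C ⊆ I, IsParticularCircuit A w C := by
  obtain ⟨l, hlI, hlA⟩ := h
  obtain ⟨C, hCI, ⟨l', hl'A, hl'C⟩, hC⟩ :=
    exists_subset_minimal_support (p := fun l => l ᵥ* A = w) hlA hlI
  exact ⟨C, hCI, ⟨l', hl'C, hl'A⟩, fun l hlC hlA => hC l hlA hlC⟩

theorem exists_isGeneralCircuit_subset {z : Fin N → 𝕜} (hz : z ∈ relationsOn A I) (hz0 : z ≠ 0) :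
    ∃ C ⊆ I, IsGeneralCircuit A C := by
  obtain ⟨C, hCI, ⟨u, ⟨hu0, huA⟩, huC⟩, hC⟩ :=
    exists_subset_minimal_support (p := fun z => z ≠ 0 ∧ z ᵥ* A = 0) ⟨hz0, hz.2⟩ hz.1
  exact ⟨C, hCI, ⟨u, hu0, huC, huA⟩, fun u hu0 huC huA => hC u ⟨hu0, huA⟩ huC⟩

theorem IsParticularCircuit.not_isGeneralCircuit {C : Finset (Fin N)}
    (hC : IsParticularCircuit A w C) : ¬ IsGeneralCircuit A C := by
  rintro ⟨⟨z, hz0, hzC, hzA⟩, -⟩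
  obtain ⟨⟨l, hlC, hlA⟩, hl⟩ := hC
  obtain ⟨i, hi⟩ := Function.ne_iff.mp hz0
  have hiC : i ∈ C := not_imp_comm.mp (hzC i) hi
  have h_erase := sub_div_smul_apply_of_notMem_erase hlC hzC hi
  refine hl (l - (l i / z i) • z) (fun j hj => h_erase j fun h => hj (Finset.mem_of_mem_erase h))
    ?_ i hiC (h_erase i (Finset.notMem_erase i C))
  rw [Matrix.sub_vecMul, Matrix.smul_vecMul, hlA, hzA, smul_zero, sub_zero]

theorem isCircuitVector_circuitVector (C : Circuit A w) :
    IsCircuitVector A w C.1 (circuitVector C) :=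
  Classical.choose_spec (exists_isCircuitVector C)

theorem circuitVector_apply_of_notMem (C : Circuit A w) {i : Fin N} (hi : i ∉ C.1) :
    circuitVector C i = 0 :=
  (isCircuitVector_circuitVector C).1 i hi

theorem circuitVector_mem_representationsOn {C : Circuit A w} (hC : IsParticularCircuit A w C.1)
    (hCI : C.1 ⊆ I) : circuitVector C ∈ representationsOn A w I := by
  refine ⟨fun i hi => circuitVector_apply_of_notMem C fun h => hi (hCI h), ?_⟩
  rcases (isCircuitVector_circuitVector C).2 with ⟨-, h⟩ | ⟨h, -⟩
  · exact h
  · exact absurd h hC.not_isGeneralCircuit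

theorem circuitVector_mem_relationsOn {C : Circuit A w} (hC : IsGeneralCircuit A C.1)
    (hCI : C.1 ⊆ I) : circuitVector C ∈ relationsOn A I := by
  refine ⟨fun i hi => circuitVector_apply_of_notMem C fun h => hi (hCI h), ?_⟩
  rcases (isCircuitVector_circuitVector C).2 with ⟨h, -⟩ | ⟨-, h, -⟩
  · exact absurd hC h.not_isGeneralCircuit
  · exact h

theorem circuitVector_ne_zero_of_isGeneralCircuit {C : Circuit A w}
    (hC : IsGeneralCircuit A C.1) : circuitVector C ≠ 0 := by
  intro h0
  rcases (isCircuitVector_circuitVector C).2 with ⟨h, -⟩ | ⟨-, -, h⟩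
  · exact h.not_isGeneralCircuit hC
  · simp [h0] at h

@[simp]
theorem divisorVector_single (C : Circuit A w) (a : 𝕜) :
    divisorVector (Finsupp.single C a) = a • circuitVector C :=
  Finsupp.linearCombination_single _ _ _

theorem generalSystemOn_mono (w : Fin n → 𝕜) {J : Finset (Fin N)} (h : J ⊆ I) :
    generalSystemOn A w J ≤ generalSystemOn A w I :=
  Submodule.span_mono fun _ ⟨C, hC, hCJ, hD⟩ => ⟨C, hC, hCJ.trans h, hD⟩

theorem map_divisorVector_generalSystemOn_le (w : Fin n → 𝕜) (I : Finset (Fin N)) :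
    (generalSystemOn A w I).map divisorVector ≤ relationsOn A I := by
  rw [generalSystemOn, Submodule.map_span_le]
  rintro _ ⟨C, hC, hCI, rfl⟩
  simpa using circuitVector_mem_relationsOn hC hCI

/-- Elimination: subtracting a multiple of a general circuit contained in the support of a relation
removes a row from that support. -/
theorem relationsOn_le_map_divisorVector (w : Fin n → 𝕜) (I : Finset (Fin N)) :
    relationsOn A I ≤ (generalSystemOn A w I).map divisorVector := by
  induction I using Finset.strongInduction with
  | H I ih =>
    intro z hz
    by_cases hz0 : z = 0
    · exact hz0 ▸ zero_mem _
    obtain ⟨C, hCI, hC⟩ := exists_isGeneralCircuit_subset hz hz0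
    let C' : Circuit A w := ⟨C, Or.inr hC⟩
    have hu : circuitVector C' ∈ relationsOn A I := circuitVector_mem_relationsOn hC hCI
    obtain ⟨i, hi⟩ := Function.ne_iff.mp
      (circuitVector_ne_zero_of_isGeneralCircuit (C := C') hC)
    have hiI : i ∈ I := not_imp_comm.mp (hu.1 i) hi
    set a := z i / circuitVector C' i
    have h_erase : z - a • circuitVector C' ∈ relationsOn A (I.erase i) :=
      ⟨sub_div_smul_apply_of_notMem_erase hz.1 hu.1 hi,
        (sub_mem hz ((relationsOn A I).smul_mem a hu)).2⟩
    have h_diff := Submodule.map_mono (generalSystemOn_mono w (Finset.erase_subset i I))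
      (ih _ (Finset.erase_ssubset hiI) h_erase)
    have h_single : divisorVector (Finsupp.single C' a) ∈
        (generalSystemOn A w I).map divisorVector := by
      rw [← mul_one a, ← smul_eq_mul, ← Finsupp.smul_single, map_smul]
      exact Submodule.smul_mem _ a
        (Submodule.mem_map_of_mem (Submodule.subset_span ⟨C', hC, hCI, rfl⟩))
    simpa using add_mem h_diff h_single

theorem map_divisorVector_generalSystemOn (w : Fin n → 𝕜) (I : Finset (Fin N)) :
    (generalSystemOn A w I).map divisorVector = relationsOn A I :=
  le_antisymm (map_divisorVector_generalSystemOn_le w I) (relationsOn_le_map_divisorVector w I)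

theorem mem_particularSystemOn_iff {D : Divisor A w} :
    D ∈ particularSystemOn A w I ↔ divisorVector D ∈ representationsOn A w I := by
  constructor
  · rintro ⟨C, hC, hCI, D', hD', h⟩
    rw [LinEquivalent, map_add, divisorVector_single, one_smul, ← sub_eq_iff_eq_add'] at h
    rw [mem_representationsOn_iff_sub_mem_relationsOn (circuitVector_mem_representationsOn hC hCI),
      h, ← map_divisorVector_generalSystemOn w]
    exact Submodule.mem_map_of_mem hD'
  · intro h
    obtain ⟨C, hCI, hC⟩ := exists_isParticularCircuit_subset ⟨_, h⟩
    let C' : Circuit A w := ⟨C, Or.inl hC⟩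
    rw [mem_representationsOn_iff_sub_mem_relationsOn
      (circuitVector_mem_representationsOn (C := C') hC hCI),
      ← map_divisorVector_generalSystemOn w] at h
    obtain ⟨D', hD', h⟩ := h
    exact ⟨C', hC, hCI, D', hD', by simp [LinEquivalent, h]⟩

end CircuitVectors

section LinearAlgebra

open EuclideanGeometry in
theorem isMinOn_norm_iff_eq_orthogonalProjection {𝕜 E : Type*} [RCLike 𝕜] [NormedAddCommGroup E]
    [InnerProductSpace 𝕜 E] {V : AffineSubspace 𝕜 E} [Nonempty V]
    [V.direction.HasOrthogonalProjection] {u : E} (hu : u ∈ V) :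
    IsMinOn norm (V : Set E) u ↔ u = orthogonalProjection V (0 : E) := by
  have h_min : ∀ v ∈ V, dist (0 : E) (orthogonalProjection V (0 : E)) ≤ ‖v‖ := fun v hv => by
    rw [dist_orthogonalProjection_eq_infDist, ← dist_zero_left]
    exact Metric.infDist_le_dist_of_mem hv
  rw [isMinOn_iff]
  constructor
  · intro h
    refine ((dist_orthogonalProjection_eq_dist_iff_eq_of_mem hu).mp (le_antisymm ?_ ?_)).symm
    · simpa [dist_comm] using h_min u hu
    · simpa [dist_comm] using h _ (orthogonalProjection_mem (0 : E))
  · rintro rfl v hv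
    simpa using h_min v hv

variable {𝕜 ι κ : Type*} [Fintype ι]

theorem exists_inner_eq_dotProduct_mulVec [RCLike 𝕜] {S : Matrix ι ι 𝕜} (hS : S.PosSemidef) :
    ∃ F : (ι → 𝕜) →ₗ[𝕜] EuclideanSpace 𝕜 ι, ∀ u v, inner 𝕜 (F u) (F v) = star u ⬝ᵥ S *ᵥ v := by
  classical
  open scoped MatrixOrder in
  obtain ⟨B, rfl⟩ := CStarAlgebra.nonneg_iff_eq_star_mul_self.mp hS.nonneg
  refine ⟨(WithLp.linearEquiv 2 𝕜 (ι → 𝕜)).symm.toLinearMap ∘ₗ B.mulVecLin, fun u v => ?_⟩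
  calc inner 𝕜 (WithLp.toLp 2 (B *ᵥ u)) (WithLp.toLp 2 (B *ᵥ v))
      = star (B *ᵥ u) ⬝ᵥ B *ᵥ v := by rw [EuclideanSpace.inner_toLp_toLp, dotProduct_comm]
    _ = star u ⬝ᵥ (star B * B) *ᵥ v := by
      rw [Matrix.star_mulVec, ← Matrix.mulVec_mulVec, Matrix.dotProduct_mulVec _ (star B),
        Matrix.star_eq_conjTranspose]

variable [RCLike 𝕜] {S : Matrix ι ι 𝕜}

theorem exists_isMinOn_quadraticForm (hS : S.PosSemidef) {V : AffineSubspace 𝕜 (ι → 𝕜)}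
    (hV : (V : Set (ι → 𝕜)).Nonempty) :
    ∃ l ∈ V, IsMinOn (fun l => RCLike.re (star l ⬝ᵥ S *ᵥ l)) V l := by
  obtain ⟨F, hF⟩ := exists_inner_eq_dotProduct_mulVec hS
  have : Nonempty (V.map F.toAffineMap) := (hV.image F).to_subtype
  obtain ⟨l, hl, hFl⟩ := EuclideanGeometry.orthogonalProjection_mem (s := V.map F.toAffineMap) 0
  refine ⟨l, hl, fun l' hl' => ?_⟩
  have h_le : ‖F l‖ ≤ ‖F l'‖ :=
    (isMinOn_norm_iff_eq_orthogonalProjection (AffineSubspace.mem_map_of_mem F.toAffineMap hl)).mpr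
      hFl (AffineSubspace.mem_map_of_mem F.toAffineMap hl')
  simp only [Set.mem_ofPred_eq, ← hF, ← norm_sq_eq_re_inner]
  gcongr

theorem dotProduct_mulVec_eq_zero_of_isMinOn (hS : S.PosSemidef) {V : AffineSubspace 𝕜 (ι → 𝕜)}
    {l z : ι → 𝕜} (hl : l ∈ V) (hmin : IsMinOn (fun l => RCLike.re (star l ⬝ᵥ S *ᵥ l)) V l)
    (hz : z ∈ V.direction) : star l ⬝ᵥ S *ᵥ z = 0 := by
  obtain ⟨F, hF⟩ := exists_inner_eq_dotProduct_mulVec hS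
  have hFl : F l ∈ V.map F.toAffineMap := AffineSubspace.mem_map_of_mem F.toAffineMap hl
  have : Nonempty (V.map F.toAffineMap) := ⟨⟨_, hFl⟩⟩
  have h_min : IsMinOn norm (V.map F.toAffineMap : Set (EuclideanSpace 𝕜 ι)) (F l) := by
    rintro _ ⟨l', hl', rfl⟩
    have := hmin hl'
    simp only [Set.mem_ofPred_eq, ← hF, ← norm_sq_eq_re_inner] at this
    exact le_of_sq_le_sq this (norm_nonneg _)
  have h_orth : F l ∈ (V.map F.toAffineMap).directionᗮ := by
    rw [(isMinOn_norm_iff_eq_orthogonalProjection hFl).mp h_min]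
    simpa using EuclideanGeometry.orthogonalProjection_vsub_mem_direction_orthogonal
      (V.map F.toAffineMap) 0
  rw [← hF]
  refine Submodule.inner_left_of_mem_orthogonal ?_ h_orth
  rw [AffineSubspace.map_direction]
  exact Submodule.mem_map_of_mem hz

theorem exists_mulVec_eq_iff {K : Type*} [Field K] [Fintype κ] {B : Matrix ι κ K} {q : ι → K} :
    (∃ v, B *ᵥ v = q) ↔ ∀ z, z ᵥ* B = 0 → z ⬝ᵥ q = 0 := by
  classical
  constructor
  · rintro ⟨v, rfl⟩ z hz
    rw [Matrix.dotProduct_mulVec, hz, zero_dotProduct]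
  · intro h
    refine (Subspace.forall_mem_dualAnnihilator_apply_eq_zero_iff
      (LinearMap.range B.mulVecLin) q).mp fun φ hφ => ?_
    obtain ⟨z, rfl⟩ := (dotProductEquiv K ι).surjective φ
    refine h z (dotProduct_eq_zero _ fun v => ?_)
    rw [← Matrix.dotProduct_mulVec]
    exact (Submodule.mem_dualAnnihilator _).mp hφ _ ⟨v, rfl⟩

theorem exists_mulVec_eqOn_iff {K : Type*} [Field K] [Fintype κ] {A : Matrix ι κ K} {q : ι → K}
    {I : Finset ι} :
    (∃ v, ∀ i ∈ I, (A *ᵥ v) i = q i) ↔ ∀ z ∈ relationsOn A I, z ⬝ᵥ q = 0 := by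
  classical
  let mask : ι → K := Set.indicator I 1
  have h_mask {v} : (∀ i ∈ I, (A *ᵥ v) i = q i) ↔
      (Matrix.diagonal mask * A) *ᵥ v = Matrix.diagonal mask *ᵥ q := by
    rw [← Matrix.mulVec_mulVec, funext_iff]
    refine forall_congr' fun i => ?_
    by_cases hi : i ∈ I <;> simp [Matrix.mulVec_diagonal, mask, hi]
  simp_rw [h_mask, exists_mulVec_eq_iff, Matrix.dotProduct_mulVec, ← Matrix.vecMul_vecMul]
  constructor
  · rintro h z ⟨hzI, hzA⟩
    have hz : z ᵥ* Matrix.diagonal mask = z := by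
      ext i
      by_cases hi : i ∈ I <;> simp [Matrix.vecMul_diagonal, mask, hi, hzI]
    simpa only [hz] using h z (by rw [hz, hzA])
  · refine fun h z hz => h _ ⟨fun i hi => ?_, hz⟩
    simp [Matrix.vecMul_diagonal, mask, hi]

theorem dotProduct_eq_of_forall_mem {R : Type*} [NonUnitalNonAssocSemiring R] {I : Finset ι}
    {l u v : ι → R} (hl : ∀ i ∉ I, l i = 0) (h : ∀ i ∈ I, u i = v i) : l ⬝ᵥ u = l ⬝ᵥ v :=
  Finset.sum_congr rfl fun i _ => by
    by_cases hi : i ∈ I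
    · rw [h i hi]
    · rw [hl i hi, zero_mul, zero_mul]

theorem exists_regression_direction [Fintype κ] (hS : S.PosSemidef) {A : Matrix ι κ 𝕜}
    {w : κ → 𝕜} (hw : w ≠ 0) {I : Finset ι} {l : ι → 𝕜} (hl : l ∈ representationsOn A w I)
    (horth : ∀ z ∈ relationsOn A I, star l ⬝ᵥ S *ᵥ z = 0) :
    ∃ v, w ⬝ᵥ v = 1 ∧ ∀ i ∈ I, (star l ᵥ* S) i = (A *ᵥ v) i * (star l ⬝ᵥ S *ᵥ l) := by
  classical
  set σ := star l ⬝ᵥ S *ᵥ l with hσ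
  by_cases hσ0 : σ = 0
  · have hSl : star l ᵥ* S = 0 := by
      have h := Matrix.star_mulVec S l
      rwa [hS.isHermitian.eq, (hS.dotProduct_mulVec_zero_iff l).mp hσ0, star_zero, eq_comm] at h
    obtain ⟨j, hj⟩ := Function.ne_iff.mp hw
    exact ⟨Pi.single j (w j)⁻¹, by simpa using mul_inv_cancel₀ hj, by simp [hSl, hσ0]⟩
  · obtain ⟨u, hu⟩ := (exists_mulVec_eqOn_iff (q := star l ᵥ* S)).mpr fun z hz => by
      rw [dotProduct_comm, ← Matrix.dotProduct_mulVec]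
      exact horth z hz
    have hwu : w ⬝ᵥ u = σ := by
      rw [← hl.2, ← Matrix.dotProduct_mulVec, dotProduct_eq_of_forall_mem hl.1 hu, hσ,
        Matrix.dotProduct_mulVec, dotProduct_comm]
    refine ⟨σ⁻¹ • u, by simp [hwu, hσ0], fun i hi => ?_⟩
    rw [Matrix.mulVec_smul, Pi.smul_apply, hu i hi, smul_eq_mul, mul_right_comm,
      inv_mul_cancel₀ hσ0, one_mul]

end LinearAlgebra

section KernelMinimizers

variable {𝕜 : Type*} [RCLike 𝕜] {N n : ℕ} {A : Matrix (Fin N) (Fin n) 𝕜} {w : Fin n → 𝕜}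
  {S : Matrix (Fin N) (Fin N) 𝕜} {L : AffineSubspace 𝕜 (Divisor A w)} {D : Divisor A w}

theorem isKernelMinimizer_iff : IsKernelMinimizer S L D ↔
    D ∈ L ∧ IsMinOn (fun l => RCLike.re (star l ⬝ᵥ S *ᵥ l))
      (L.map (divisorVector (A := A) (w := w)).toAffineMap) (divisorVector D) := by
  simp [IsKernelMinimizer, isMinOn_iff, circuitKernel]

theorem exists_isKernelMinimizer (hS : S.PosSemidef) (hL : (L : Set (Divisor A w)).Nonempty) :
    ∃ D, IsKernelMinimizer S L D := by
  obtain ⟨_, ⟨D, hD, rfl⟩, hmin⟩ := exists_isMinOn_quadraticForm hS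
    (V := L.map (divisorVector (A := A) (w := w)).toAffineMap) (hL.image _)
  exact ⟨D, isKernelMinimizer_iff.mpr ⟨hD, hmin⟩⟩

theorem IsKernelMinimizer.dotProduct_mulVec_eq_zero (hD : IsKernelMinimizer S L D)
    (hS : S.PosSemidef) {I : Finset (Fin N)}
    (hI : particularSystemOn A w I ⊆ (L : Set (Divisor A w)))
    (hDI : divisorVector D ∈ representationsOn A w I) {z : Fin N → 𝕜} (hz : z ∈ relationsOn A I) :
    star (divisorVector D) ⬝ᵥ S *ᵥ z = 0 := by
  rw [isKernelMinimizer_iff] at hD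
  refine dotProduct_mulVec_eq_zero_of_isMinOn hS (AffineSubspace.mem_map_of_mem _ hD.1) hD.2 ?_
  rw [← map_divisorVector_generalSystemOn w] at hz
  obtain ⟨D', hD', rfl⟩ := hz
  rw [AffineSubspace.map_direction]
  refine Submodule.mem_map_of_mem ((AffineSubspace.vadd_mem_iff_mem_direction _ hD.1).mp (hI ?_))
  rw [vadd_eq_add, mem_particularSystemOn_iff, mem_representationsOn_iff_sub_mem_relationsOn hDI,
    map_add, add_sub_cancel_right, ← map_divisorVector_generalSystemOn w]
  exact Submodule.mem_map_of_mem hD'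

end KernelMinimizers

section LaplaceTransform

variable {E : Type*} [NormedAddCommGroup E] [NormedSpace ℝ E] [MeasurableSpace E] [BorelSpace E]
  [SecondCountableTopology E] [CompleteSpace E]

/-- The Laplace transform extends to a holomorphic function of a complex multiple of `l`, whose
value at `i` is the characteristic function. -/
theorem measure_ext_of_integral_exp_eq {μ ν : Measure E} [IsFiniteMeasure μ] [IsFiniteMeasure ν]
    (hμ : ∀ l : StrongDual ℝ E, Integrable (fun x => Real.exp (l x)) μ)
    (h : ∀ l : StrongDual ℝ E, ∫ x, Real.exp (l x) ∂μ = ∫ x, Real.exp (l x) ∂ν) : μ = ν := by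
  have h_zero : μ = 0 ↔ ν = 0 := by
    have h_univ : μ.real Set.univ = ν.real Set.univ := by simpa using h 0
    rw [← Measure.measure_univ_eq_zero, ← Measure.measure_univ_eq_zero,
      ← measureReal_eq_zero_iff, ← measureReal_eq_zero_iff, h_univ]
  refine Measure.ext_of_charFunDual (funext fun l => ?_)
  have h_mgf : mgf l μ = mgf l ν := funext fun t => by simpa [mgf] using h (t • l)
  have h_set : integrableExpSet l μ = Set.univ :=
    Set.eq_univ_of_forall fun t => by simpa [integrableExpSet] using hμ (t • l)
  simpa [charFunDual_apply, complexMGF, mul_comm] using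
    eqOn_complexMGF_of_mgf' h_mgf h_zero (x := Complex.I) (by simp [h_set])

variable {ν : Measure E}

theorem ae_eq_of_forall_integral_smul_exp_eq {f g : E → ℝ≥0} (hf : Measurable f)
    (hg : Measurable g)
    (hf_int : ∀ l : StrongDual ℝ E, Integrable (fun x => f x • Real.exp (l x)) ν)
    (hg_int : ∀ l : StrongDual ℝ E, Integrable (fun x => g x • Real.exp (l x)) ν)
    (h : ∀ l : StrongDual ℝ E, ∫ x, f x • Real.exp (l x) ∂ν = ∫ x, g x • Real.exp (l x) ∂ν) :
    f =ᵐ[ν] g := by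
  have lintegral_lt_top {f : E → ℝ≥0}
      (hf : Integrable (fun x => f x • Real.exp ((0 : StrongDual ℝ E) x)) ν) :
      ∫⁻ x, f x ∂ν < ∞ := by
    simpa [HasFiniteIntegral, NNReal.smul_def] using hf.2
  have hf_lt := lintegral_lt_top (hf_int 0)
  have := isFiniteMeasure_withDensity hf_lt.ne
  have := isFiniteMeasure_withDensity (lintegral_lt_top (hg_int 0)).ne
  have h_eq : ν.withDensity (fun x => f x) = ν.withDensity fun x => g x :=
    measure_ext_of_integral_exp_eq
      (fun l => (integrable_withDensity_iff_integrable_smul hf).mpr (hf_int l)) fun l => by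
        rw [integral_withDensity_eq_integral_smul hf, integral_withDensity_eq_integral_smul hg, h]
  rw [withDensity_eq_iff (by fun_prop) (by fun_prop) hf_lt.ne] at h_eq
  simpa only [Filter.EventuallyEq, ENNReal.coe_inj] using h_eq

theorem ae_eq_zero_of_forall_integral_exp_mul_eq_zero {g : E → ℝ} (hg : Measurable g)
    (hg_int : ∀ l : StrongDual ℝ E, Integrable (fun x => Real.exp (l x) * g x) ν)
    (h : ∀ l : StrongDual ℝ E, ∫ x, Real.exp (l x) * g x ∂ν = 0) : g =ᵐ[ν] 0 := by
  have h_pos (l : StrongDual ℝ E) : Integrable (fun x => (g x).toNNReal • Real.exp (l x)) ν := by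
    refine (hg_int l).pos_part.congr (ae_of_all _ fun x => ?_)
    simp [NNReal.smul_def, mul_comm, max_mul_of_nonneg, (Real.exp_pos _).le]
  have h_neg (l : StrongDual ℝ E) : Integrable (fun x => (-g x).toNNReal • Real.exp (l x)) ν := by
    refine (hg_int l).neg_part.congr (ae_of_all _ fun x => ?_)
    simp [NNReal.smul_def, mul_comm, max_mul_of_nonneg, (Real.exp_pos _).le, ← neg_mul]
  have h_parts : (fun x => (g x).toNNReal) =ᵐ[ν] fun x => (-g x).toNNReal := by
    refine ae_eq_of_forall_integral_smul_exp_eq (by fun_prop) (by fun_prop) h_pos h_neg fun l => ?_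
    rw [← sub_eq_zero, ← integral_sub (h_pos l) (h_neg l), ← h l]
    refine integral_congr_ae (ae_of_all _ fun x => ?_)
    simp only [NNReal.smul_def, Real.coe_toNNReal', smul_eq_mul, ← sub_mul,
      max_zero_sub_max_neg_zero_eq_self, mul_comm]
  filter_upwards [h_parts] with x hx
  have := congrArg NNReal.toReal hx
  rw [Real.coe_toNNReal', Real.coe_toNNReal'] at this
  simpa [this] using (max_zero_sub_max_neg_zero_eq_self (g x)).symm

theorem ae_eq_zero_of_forall_integral_exp_smul_eq_zero {F : Type*} [NormedAddCommGroup F]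
    [NormedSpace ℝ F] [CompleteSpace F] [SecondCountableTopology F] {g : E → F}
    (hg : StronglyMeasurable g)
    (hg_int : ∀ l : StrongDual ℝ E, Integrable (fun x => Real.exp (l x) • g x) ν)
    (h : ∀ l : StrongDual ℝ E, ∫ x, Real.exp (l x) • g x ∂ν = 0) : g =ᵐ[ν] 0 := by
  refine ae_eq_zero_of_forall_dual ℝ fun c =>
    ae_eq_zero_of_forall_integral_exp_mul_eq_zero
      (c.continuous.comp_stronglyMeasurable hg).measurable (fun l => ?_) fun l => ?_
  · simpa using c.integrable_comp (hg_int l)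
  · simpa [h l] using c.integral_comp_comm (hg_int l)

end LaplaceTransform

section GaussianTranslates

variable {E : Type*} [NormedAddCommGroup E] [NormedSpace ℝ E] [MeasurableSpace E] [BorelSpace E]
  {ν : Measure E} [IsGaussian ν]

theorem integrable_exp_dual (l : StrongDual ℝ E) : Integrable (fun x => Real.exp (l x)) ν := by
  have h := integrable_exp_mul_gaussianReal (μ := ν[l]) (v := (Var[l; ν]).toNNReal) 1
  rw [← IsGaussian.map_eq_gaussianReal l, integrable_map_measure (by fun_prop) (by fun_prop)] at h
  simpa [Function.comp_def] using h

variable [SecondCountableTopology E] [CompleteSpace E]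

theorem integral_exp_dual (hν : ∫ x, x ∂ν = 0) (l : StrongDual ℝ E) :
    ∫ x, Real.exp (l x) ∂ν = Real.exp (Var[l; ν] / 2) := by
  have h := mgf_gaussianReal (IsGaussian.map_eq_gaussianReal (μ := ν) l) 1
  have h_mean : ν[l] = 0 := by rw [IsGaussian.integral_dual, hν, map_zero]
  simpa [mgf, h_mean, Real.coe_toNNReal _ (variance_nonneg _ _)] using h

theorem covariance_dual_eq_apply_integral_smul (hν : ∫ x, x ∂ν = 0) (k l : StrongDual ℝ E) :
    cov[k, l; ν] = k (∫ x, l x • x ∂ν) := by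
  have h_int : Integrable (fun x => l x • x) ν :=
    memLp_one_iff_integrable.mp (MemLp.smul (q := 2) (p := 2) (IsGaussian.memLp_two_id (μ := ν))
      (IsGaussian.memLp_dual ν l 2 (by simp)))
  rw [covariance_eq_sub (IsGaussian.memLp_dual ν k 2 (by simp))
    (IsGaussian.memLp_dual ν l 2 (by simp)), IsGaussian.integral_dual, hν, map_zero, zero_mul,
    sub_zero, ← k.integral_comp_comm h_int]
  simp [mul_comm]

/-- **Cameron–Martin**, with the translation by an element of the Cameron–Martin space written as
an exponential tilt. -/
theorem map_add_eq_tilted (hν : ∫ x, x ∂ν = 0) (l : StrongDual ℝ E) :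
    ν.map (fun x => (∫ y, l y • y ∂ν) + x) = ν.tilted l := by
  have h_int := integrable_exp_dual (ν := ν)
  have := isProbabilityMeasure_tilted (h_int l)
  set m := ∫ y, l y • y ∂ν with hm
  have h_exp (k : StrongDual ℝ E) (x : E) :
      Real.exp (k (m + x)) = Real.exp (k m) * Real.exp (k x) := by rw [map_add, Real.exp_add]
  refine measure_ext_of_integral_exp_eq (fun k => ?_) fun k => ?_
  · rw [integrable_map_measure (by fun_prop) (by fun_prop)]
    simpa only [Function.comp_def, h_exp] using (h_int k).const_mul (Real.exp (k m))
  · have h_var : Var[(l + k : StrongDual ℝ E); ν] = Var[l; ν] + 2 * k m + Var[k; ν] := by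
      rw [hm, ← covariance_dual_eq_apply_integral_smul hν, covariance_comm]
      exact variance_add (IsGaussian.memLp_dual ν l 2 (by simp))
        (IsGaussian.memLp_dual ν k 2 (by simp))
    rw [integral_map (by fun_prop) (by fun_prop), integral_exp_tilted]
    simp_rw [h_exp]
    rw [integral_const_mul, integral_exp_dual hν, integral_exp_dual hν l]
    change _ = (∫ x, Real.exp ((l + k) x) ∂ν) / _
    rw [integral_exp_dual hν, h_var, ← Real.exp_add, ← Real.exp_sub]
    ring_nf

theorem ae_eq_zero_of_forall_integral_add_eq_zero {F : Type*} [NormedAddCommGroup F]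
    [NormedSpace ℝ F] [CompleteSpace F] [SecondCountableTopology F] (hν : ∫ x, x ∂ν = 0) {g : E → F}
    (hg : StronglyMeasurable g) (hg_int : ∀ m, Integrable (fun x => g (m + x)) ν)
    (h : ∀ m, ∫ x, g (m + x) ∂ν = 0) : g =ᵐ[ν] 0 := by
  have h_pos (l : StrongDual ℝ E) : 0 < ∫ x, Real.exp (l x) ∂ν := by
    rw [integral_exp_dual hν]
    exact Real.exp_pos _
  refine ae_eq_zero_of_forall_integral_exp_smul_eq_zero hg (fun l => ?_) fun l => ?_
  · have h_tilted := hg_int (∫ y, l y • y ∂ν)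
    change Integrable (g ∘ _) ν at h_tilted
    rwa [← integrable_map_measure hg.aestronglyMeasurable (by fun_prop), map_add_eq_tilted hν,
      integrable_tilted_iff (integrable_exp_dual l)] at h_tilted
  · have h_tilted := h (∫ y, l y • y ∂ν)
    rw [← integral_map (φ := fun x => _ + x) (by fun_prop) hg.aestronglyMeasurable,
      map_add_eq_tilted hν, integral_tilted] at h_tilted
    simp_rw [div_eq_inv_mul, mul_smul] at h_tilted
    rw [integral_smul] at h_tilted
    exact (smul_eq_zero.mp h_tilted).resolve_left (inv_ne_zero (h_pos l).ne')

end GaussianTranslates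

section Independence

variable {𝕜 Ω F : Type*} [RCLike 𝕜] [MeasurableSpace Ω] {P : Measure Ω} [NormedAddCommGroup F]
  [NormedSpace ℝ F] [NormedSpace 𝕜 F] [IsScalarTower ℝ 𝕜 F]

theorem re_mul_apply_eq (l : F →L[ℝ] ℝ) (u : 𝕜) (y : F) :
    RCLike.re u * l y = 2⁻¹ * l (u • y + star u • y) := by
  have h_smul : u • y + star u • y = (2 * RCLike.re u) • y := by
    rw [← add_smul, RCLike.star_def, RCLike.add_conj, ← algebraMap_smul 𝕜 (2 * RCLike.re u) y,
      RCLike.algebraMap_eq_ofReal, RCLike.ofReal_mul, RCLike.ofReal_ofNat]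
  rw [h_smul, map_smul, smul_eq_mul]
  ring

/-- Every real functional on `𝕜` is `z ↦ re (c * z)` for some `c`, and twice the real part of `u` is
`u + star u`: this reduces the real covariances to the two `𝕜`-valued ones. -/
theorem indepFun_of_hasGaussianLaw_of_integral_smul_eq_zero [CompleteSpace F]
    [SecondCountableTopology F] [MeasurableSpace F] [BorelSpace F] {f : Ω → 𝕜} {g : Ω → F}
    (hfg : HasGaussianLaw (fun ω => (f ω, g ω)) P) (hf : ∫ ω, f ω ∂P = 0)
    (h : ∫ ω, f ω • g ω ∂P = 0) (h_star : ∫ ω, star (f ω) • g ω ∂P = 0) : IndepFun f g P := by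
  have hP := hfg.isProbabilityMeasure
  have hf_memLp : MemLp f 2 P := hfg.fst.memLp_two
  have hg_memLp : MemLp g 2 P := hfg.snd.memLp_two
  refine HasGaussianLaw.indepFun_of_covariance_strongDual hfg fun k l => ?_
  obtain ⟨c, hc⟩ : ∃ c : 𝕜, ∀ z, k z = RCLike.re (c * z) :=
    ⟨(k.extendRCLike : StrongDual 𝕜 𝕜) 1, fun z => by
      rw [← StrongDual.re_extendRCLike_apply (𝕜 := 𝕜) k z, mul_comm, ← smul_eq_mul, ← map_smul,
        smul_eq_mul, mul_one]⟩
  have h_int : Integrable (fun ω => c • f ω • g ω) P :=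
    (memLp_one_iff_integrable.mp (hg_memLp.smul hf_memLp)).smul c
  have h_int_star : Integrable (fun ω => star c • star (f ω) • g ω) P :=
    (memLp_one_iff_integrable.mp (hg_memLp.smul hf_memLp.star)).smul (star c)
  have h_eq (ω : Ω) : k (f ω) * l (g ω) =
      2⁻¹ * l (c • f ω • g ω + star c • star (f ω) • g ω) := by
    rw [hc, re_mul_apply_eq, star_mul', mul_smul, mul_smul]
  have h_zero : ∫ ω, k (f ω) * l (g ω) ∂P = 0 := by
    simp_rw [h_eq]
    rw [integral_const_mul, l.integral_comp_comm (φ := fun ω => _ + _) (h_int.add h_int_star),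
      integral_add h_int h_int_star, integral_smul, integral_smul, h, h_star]
    simp
  rw [covariance_eq_sub (k.comp_memLp' hf_memLp) (l.comp_memLp' hg_memLp)]
  change ∫ ω, k (f ω) * l (g ω) ∂P - (∫ ω, k (f ω) ∂P) * _ = 0
  rw [h_zero, k.integral_comp_comm (hf_memLp.integrable one_le_two), hf, map_zero]
  simp

end Independence

section Noise

variable {𝕜 : Type*} [RCLike 𝕜] {N : ℕ} {μ : Measure (Fin N → 𝕜)}

theorem star_eq_self_of_I_eq_zero (h : (RCLike.I : 𝕜) = 0) (z : 𝕜) : star z = z := by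
  rw [RCLike.star_def, RCLike.conj_eq_iff_im, ← RCLike.I_im z, h, map_zero, mul_zero]

namespace IsGaussianNoise

theorem memLp_two_eval (hμ : IsGaussianNoise μ) (i : Fin N) : MemLp (fun e => e i) 2 μ := by
  have := hμ.gaussian
  exact (ContinuousLinearMap.proj (R := ℝ) (φ := fun _ => 𝕜) i).comp_memLp' IsGaussian.memLp_two_id

theorem memLp_two_dotProduct (hμ : IsGaussianNoise μ) (l : Fin N → 𝕜) :
    MemLp (fun e => l ⬝ᵥ e) 2 μ :=
  memLp_finsetSum _ fun i _ => (hμ.memLp_two_eval i).const_mul (l i)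

theorem integral_dotProduct (hμ : IsGaussianNoise μ) (l : Fin N → 𝕜) : ∫ e, l ⬝ᵥ e ∂μ = 0 := by
  have := hμ.gaussian
  simp only [dotProduct]
  rw [integral_finsetSum _ fun i _ =>
    ((hμ.memLp_two_eval i).integrable one_le_two).const_mul (l i)]
  simp [integral_const_mul, hμ.centered]

theorem integrable_eval_mul_eval (hμ : IsGaussianNoise μ) (i j : Fin N) :
    Integrable (fun e => e i * e j) μ :=
  (hμ.memLp_two_eval i).integrable_mul (hμ.memLp_two_eval j)

theorem integrable_star_eval_mul_eval (hμ : IsGaussianNoise μ) (i j : Fin N) :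
    Integrable (fun e => star (e i) * e j) μ :=
  (hμ.memLp_two_eval i).star.integrable_mul (hμ.memLp_two_eval j)

theorem integrable_star_dotProduct_smul (hμ : IsGaussianNoise μ) (l : Fin N → 𝕜) :
    Integrable (fun e => star (l ⬝ᵥ e) • e) μ := by
  have := hμ.gaussian
  exact memLp_one_iff_integrable.mp
    ((IsGaussian.memLp_two_id (μ := μ)).smul (hμ.memLp_two_dotProduct l).star)

theorem integrable_dotProduct_smul (hμ : IsGaussianNoise μ) (l : Fin N → 𝕜) :
    Integrable (fun e => (l ⬝ᵥ e) • e) μ := by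
  have := hμ.gaussian
  exact memLp_one_iff_integrable.mp
    ((IsGaussian.memLp_two_id (μ := μ)).smul (hμ.memLp_two_dotProduct l))

theorem integral_star_dotProduct_smul (hμ : IsGaussianNoise μ) (l : Fin N → 𝕜) :
    ∫ e, star (l ⬝ᵥ e) • e ∂μ = star l ᵥ* noiseCov μ := by
  ext j
  rw [eval_integral fun j => (hμ.integrable_star_dotProduct_smul l).eval j]
  simp only [Pi.smul_apply, smul_eq_mul, dotProduct, star_sum, star_mul', Finset.sum_mul, mul_assoc]
  rw [integral_finsetSum _ fun i _ => (hμ.integrable_star_eval_mul_eval i j).const_mul (star (l i))]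
  simp only [integral_const_mul]
  rfl

theorem integral_dotProduct_smul (hμ : IsGaussianNoise μ) (hI : (RCLike.I : 𝕜) ≠ 0)
    (l : Fin N → 𝕜) : ∫ e, (l ⬝ᵥ e) • e ∂μ = 0 := by
  ext j
  rw [eval_integral fun j => (hμ.integrable_dotProduct_smul l).eval j]
  simp only [Pi.smul_apply, smul_eq_mul, dotProduct, Finset.sum_mul, mul_assoc]
  rw [integral_finsetSum _ fun i _ => (hμ.integrable_eval_mul_eval i j).const_mul (l i)]
  simp [integral_const_mul, hμ.circular hI]

theorem posSemidef_noiseCov (hμ : IsGaussianNoise μ) : (noiseCov μ).PosSemidef := by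
  refine .of_dotProduct_mulVec_nonneg ?_ fun z => ?_
  · ext i j
    rw [Matrix.conjTranspose_apply, RCLike.star_def]
    simp only [noiseCov, Matrix.of_apply]
    rw [← integral_conj]
    simp [mul_comm]
  · have h_form : star z ⬝ᵥ noiseCov μ *ᵥ z = ∫ e, star (z ⬝ᵥ e) * (z ⬝ᵥ e) ∂μ := by
      rw [Matrix.dotProduct_mulVec, ← hμ.integral_star_dotProduct_smul, dotProduct_comm]
      refine ((dotProductBilin 𝕜 𝕜 z).toContinuousLinearMap.integral_comp_comm
        (hμ.integrable_star_dotProduct_smul z)).symm.trans ?_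
      simp
    rw [h_form]
    simp only [RCLike.star_def, RCLike.conj_mul]
    exact_mod_cast integral_nonneg fun e => sq_nonneg ‖z ⬝ᵥ e‖

theorem indepFun_dotProduct {F : Type*} [NormedAddCommGroup F] [NormedSpace ℝ F] [NormedSpace 𝕜 F]
    [IsScalarTower ℝ 𝕜 F] [CompleteSpace F] [SecondCountableTopology F] [MeasurableSpace F]
    [BorelSpace F] (hμ : IsGaussianNoise μ) {l : Fin N → 𝕜} {G : (Fin N → 𝕜) →L[𝕜] F}
    (hG : G (star l ᵥ* noiseCov μ) = 0) : IndepFun (fun e => l ⬝ᵥ e) G μ := by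
  have := hμ.gaussian
  have h_star : ∫ e, star (l ⬝ᵥ e) • G e ∂μ = 0 := by
    simp_rw [← map_smul]
    rw [G.integral_comp_comm (hμ.integrable_star_dotProduct_smul l),
      hμ.integral_star_dotProduct_smul, hG]
  let T : (Fin N → 𝕜) →L[𝕜] 𝕜 := (dotProductBilin 𝕜 𝕜 l).toContinuousLinearMap
  refine indepFun_of_hasGaussianLaw_of_integral_smul_eq_zero
    (IsGaussian.hasGaussianLaw_id.map ((T.prod G).restrictScalars ℝ)) (hμ.integral_dotProduct l)
    ?_ h_star
  by_cases hI : (RCLike.I : 𝕜) = 0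
  · simpa only [star_eq_self_of_I_eq_zero hI] using h_star
  · simp_rw [← map_smul]
    rw [G.integral_comp_comm (hμ.integrable_dotProduct_smul l), hμ.integral_dotProduct_smul hI,
      map_zero]

end IsGaussianNoise

end Noise

section Estimation

variable {𝕜 Θ Y : Type*} [RCLike 𝕜] [MeasurableSpace Y] {P : Θ → Measure Y} {g : Θ → 𝕜}
  {U V : Y → 𝕜}

theorem IsUnbiased.comp {Θ' : Type*} (hU : IsUnbiased P g U) (f : Θ' → Θ) :
    IsUnbiased (fun θ => P (f θ)) (fun θ => g (f θ)) U :=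
  ⟨hU.1, fun θ => hU.2 (f θ)⟩

theorem IsUnbiased.midpoint (hU : IsUnbiased P g U) (hV : IsUnbiased P g V) :
    IsUnbiased P g fun y => 2⁻¹ * (U y + V y) := by
  refine ⟨(hU.1.add hV.1).const_mul _, fun θ => ⟨((hU.2 θ).1.add (hV.2 θ).1).const_mul _, ?_⟩⟩
  rw [integral_const_mul, integral_add (hU.2 θ).1 (hV.2 θ).1, (hU.2 θ).2, (hV.2 θ).2, ← two_mul,
    inv_mul_cancel_left₀ two_ne_zero]

theorem IsUnbiased.eVar_eq (hU : IsUnbiased P g U) (θ : Θ) :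
    eVar U (P θ) = ∫⁻ y, ‖U y - g θ‖ₑ ^ 2 ∂(P θ) := by
  rw [eVar, (hU.2 θ).2]

theorem isMVUE_of_forall_fiber {H : Type*} {η : Θ → H} (hU : IsUnbiased P g U)
    (h_fiber : ∀ h, IsMVUE (fun θ : {θ // η θ = h} => P θ) (fun θ => g θ) U) : IsMVUE P g U :=
  ⟨hU, fun _ hU' θ => (h_fiber (η θ)).2 _ (hU'.comp Subtype.val) ⟨θ, rfl⟩⟩

theorem four_mul_enorm_midpoint_sub_sq_add (u v c : 𝕜) :
    4 * ‖2⁻¹ * (u + v) - c‖ₑ ^ 2 + ‖u - v‖ₑ ^ 2 = 2 * (‖u - c‖ₑ ^ 2 + ‖v - c‖ₑ ^ 2) := by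
  have h_mid : ‖(u - c) + (v - c)‖ = 2 * ‖2⁻¹ * (u + v) - c‖ := by
    rw [← RCLike.norm_ofNat (K := 𝕜) 2, ← norm_mul]
    congr 1
    field_simp
    ring
  have h_diff : ‖(u - c) - (v - c)‖ = ‖u - v‖ := by rw [sub_sub_sub_cancel_right]
  have h_real := parallelogram_law_with_norm 𝕜 (u - c) (v - c)
  rw [h_mid, h_diff] at h_real
  rw [← ENNReal.toReal_eq_toReal_iff' (by finiteness) (by finiteness),
    ENNReal.toReal_add (by finiteness) (by finiteness)]
  simp only [ENNReal.toReal_mul, ENNReal.toReal_pow, toReal_enorm, ENNReal.toReal_ofNat]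
  rw [ENNReal.toReal_add (by finiteness) (by finiteness)]
  simp only [ENNReal.toReal_pow, toReal_enorm]
  linarith

/-- The midpoint of two minimum variance unbiased estimators is unbiased, and by the parallelogram
identity it would have a smaller variance if they were different. -/
theorem IsMVUE.ae_eq (hU : IsMVUE P g U) (hV : IsMVUE P g V) {θ : Θ} (hfin : eVar V (P θ) ≠ ∞) :
    U =ᵐ[P θ] V := by
  have hU_meas := hU.1.1
  have hV_meas := hV.1.1
  have h_mid := hU.1.midpoint hV.1
  have h_eq : eVar U (P θ) = eVar V (P θ) := (hU.2 V hV.1 θ).antisymm (hV.2 U hU.1 θ)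
  have h_parallelogram :
      4 * eVar (fun y => 2⁻¹ * (U y + V y)) (P θ) + ∫⁻ y, ‖U y - V y‖ₑ ^ 2 ∂(P θ) =
        4 * eVar V (P θ) := by
    calc _ = ∫⁻ y, 2 * (‖U y - g θ‖ₑ ^ 2 + ‖V y - g θ‖ₑ ^ 2) ∂(P θ) := by
          rw [h_mid.eVar_eq, ← lintegral_const_mul _ (by fun_prop),
            ← lintegral_add_left (by fun_prop)]
          simp only [four_mul_enorm_midpoint_sub_sq_add]
      _ = 2 * (eVar U (P θ) + eVar V (P θ)) := by
          rw [lintegral_const_mul _ (by fun_prop), lintegral_add_left (by fun_prop),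
            hU.1.eVar_eq, hV.1.eVar_eq]
      _ = 4 * eVar V (P θ) := by rw [h_eq]; ring
  have h_diff : ∫⁻ y, ‖U y - V y‖ₑ ^ 2 ∂(P θ) = 0 := by
    have h_fin : 4 * eVar V (P θ) ≠ ∞ := ENNReal.mul_ne_top (by simp) hfin
    refine le_zero_iff.mp ((ENNReal.add_le_add_iff_left h_fin).mp ?_)
    rw [add_zero, ← h_parallelogram]
    gcongr
    rw [h_parallelogram]
    gcongr
    exact hV.2 _ h_mid θ
  rw [lintegral_eq_zero_iff (by fun_prop)] at h_diff
  filter_upwards [h_diff] with y hy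
  simpa [sub_eq_zero] using hy

theorem eVar_ne_top_of_memLp {ν : Measure Y} [IsFiniteMeasure ν] (hU : MemLp U 2 ν) :
    eVar U ν ≠ ∞ := by
  have h := (hU.sub (memLp_const (∫ y, U y ∂ν))).eLpNorm_lt_top
  rw [eLpNorm_lt_top_iff_lintegral_rpow_enorm_lt_top two_ne_zero ENNReal.ofNat_ne_top] at h
  simpa [eVar] using h.ne

end Estimation

section LehmannScheffe

theorem enorm_integral_sq_le_lintegral {F Y : Type*} [NormedAddCommGroup F] [NormedSpace ℝ F]
    [MeasurableSpace Y] {ν : Measure Y} [IsProbabilityMeasure ν] {f : Y → F}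
    (hf : AEStronglyMeasurable f ν) : ‖∫ y, f y ∂ν‖ₑ ^ 2 ≤ ∫⁻ y, ‖f y‖ₑ ^ 2 ∂ν := by
  have h := (enorm_integral_le_lintegral_enorm f).trans
    ((eLpNorm_one_eq_lintegral_enorm (f := f) (μ := ν)).symm.le.trans
      (eLpNorm_le_eLpNorm_of_exponent_le one_le_two hf))
  rw [eLpNorm_eq_lintegral_rpow_enorm_toReal two_ne_zero ENNReal.ofNat_ne_top, one_div,
    ENNReal.le_rpow_inv_iff (by norm_num)] at h
  simpa using h

variable {𝕜 Θ Y Z : Type*} [RCLike 𝕜] [MeasurableSpace Y] [MeasurableSpace Z]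

theorem lintegral_enorm_integral_kernel_sub_sq_le {ν : Measure Z} {κ : Kernel Z Y}
    [IsMarkovKernel κ] {U : Y → 𝕜} (hU : Measurable U) (hU_int : Integrable U (κ ∘ₘ ν)) (c : 𝕜) :
    ∫⁻ t, ‖∫ y, U y ∂(κ t) - c‖ₑ ^ 2 ∂ν ≤ ∫⁻ y, ‖U y - c‖ₑ ^ 2 ∂(κ ∘ₘ ν) := by
  rw [Measure.lintegral_bind (by fun_prop) (by fun_prop)]
  refine lintegral_mono_ae ?_
  filter_upwards [Measure.ae_integrable_of_integrable_comp hU_int] with t ht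
  refine le_trans (le_of_eq ?_) (enorm_integral_sq_le_lintegral (by fun_prop))
  rw [integral_sub ht (integrable_const c)]
  simp

theorem integrable_integral_kernel {ν : Measure Z} {κ : Kernel Z Y} {U : Y → 𝕜}
    (hU : Integrable U (κ ∘ₘ ν)) : Integrable (fun t => ∫ y, U y ∂(κ t)) ν := by
  rw [Measure.comp_eq_comp_const_apply] at hU
  exact hU.integral_comp

theorem integral_integral_kernel {ν : Measure Z} {κ : Kernel Z Y} {U : Y → 𝕜}
    (hU : Integrable U (κ ∘ₘ ν)) : ∫ t, ∫ y, U y ∂(κ t) ∂ν = ∫ y, U y ∂(κ ∘ₘ ν) := by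
  rw [Measure.comp_eq_comp_const_apply] at hU ⊢
  exact (Kernel.integral_comp hU).symm

variable {P : Θ → Measure Y} {g : Θ → 𝕜} {T : Y → Z} {φ : Z → 𝕜}

theorem IsSufficientStatistic.exists_comp_eq [∀ θ, SFinite (P θ)]
    (hs : IsSufficientStatistic P T) (hT : Measurable T) :
    ∃ κ : Kernel Z Y, IsMarkovKernel κ ∧ ∀ θ, κ ∘ₘ (P θ).map T = P θ := by
  obtain ⟨κ, hκ, h⟩ := hs
  refine ⟨κ, hκ, fun θ => ?_⟩
  rw [← Measure.snd_compProd, ← h, Measure.snd_map_prodMk hT, Measure.map_id']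

/-- **Lehmann–Scheffé**: averaging an unbiased estimator over the conditional law given `T` does not
increase its variance, and by completeness the average is `φ ∘ T`. -/
theorem isMVUE_of_isCompleteStatistic_of_isSufficientStatistic [∀ θ, SFinite (P θ)]
    (hT : Measurable T) (hφ : Measurable φ) (hc : IsCompleteStatistic 𝕜 P T)
    (hs : IsSufficientStatistic P T) (hu : IsUnbiased P g fun y => φ (T y)) :
    IsMVUE P g fun y => φ (T y) := by
  obtain ⟨κ, hκ, hκP⟩ := hs.exists_comp_eq hT
  refine ⟨hu, fun U hU θ => ?_⟩
  let V (t : Z) : 𝕜 := ∫ y, U y ∂(κ t)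
  have hV_meas : Measurable V := hU.1.stronglyMeasurable.integral_kernel.measurable
  have hU_int (θ : Θ) : Integrable U (κ ∘ₘ (P θ).map T) := by
    rw [hκP]
    exact (hU.2 θ).1
  have hV_int (θ : Θ) : Integrable (fun y => V (T y)) (P θ) :=
    ((integrable_map_measure hV_meas.aestronglyMeasurable hT.aemeasurable).mp
      (integrable_integral_kernel (hU_int θ)))
  have hV_integral (θ : Θ) : ∫ y, V (T y) ∂(P θ) = g θ := by
    rw [← integral_map (f := V) hT.aemeasurable hV_meas.aestronglyMeasurable,
      integral_integral_kernel (hU_int θ), hκP, (hU.2 θ).2]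
  have hV_eq : ∀ᵐ y ∂(P θ), V (T y) = φ (T y) := by
    filter_upwards [hc (fun t => V t - φ t) (hV_meas.sub hφ) (fun θ => (hV_int θ).sub (hu.2 θ).1)
      (fun θ => by rw [integral_sub (hV_int θ) (hu.2 θ).1, hV_integral, (hu.2 θ).2, sub_self]) θ]
      with y hy
    exact sub_eq_zero.mp hy
  calc eVar (fun y => φ (T y)) (P θ)
    _ = ∫⁻ y, ‖V (T y) - g θ‖ₑ ^ 2 ∂(P θ) := by
        rw [hu.eVar_eq]
        refine lintegral_congr_ae ?_
        filter_upwards [hV_eq] with y hy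
        rw [hy]
    _ = ∫⁻ t, ‖V t - g θ‖ₑ ^ 2 ∂((P θ).map T) :=
        (lintegral_map (f := fun t => ‖V t - g θ‖ₑ ^ 2) (by fun_prop) hT).symm
    _ ≤ ∫⁻ y, ‖U y - g θ‖ₑ ^ 2 ∂(κ ∘ₘ (P θ).map T) :=
        lintegral_enorm_integral_kernel_sub_sq_le hU.1 (hU_int θ) _
    _ = eVar U (P θ) := by rw [hκP, hU.eVar_eq]

theorem map_prodMk_fst_prod_eq_compProd {R : Type*} [MeasurableSpace R] (ν : Measure Z) [SFinite ν]
    (ρ : Measure R) [SFinite ρ] {Φ : Z × R → Y} (hΦ : Measurable Φ) :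
    (ν.prod ρ).map (fun p => (p.1, Φ p)) = ν ⊗ₘ (Kernel.id ×ₖ Kernel.const Z ρ).map Φ := by
  have h_meas : Measurable fun p : Z × R => (p.1, Φ p) := measurable_fst.prodMk hΦ
  ext s hs
  rw [Measure.map_apply h_meas hs, Measure.compProd_apply hs, Measure.prod_apply (h_meas hs)]
  refine lintegral_congr fun t => ?_
  rw [Kernel.map_apply' _ hΦ _ (measurable_prodMk_left hs), Kernel.prod_apply, Kernel.id_apply,
    Kernel.const_apply, Measure.dirac_prod, Measure.map_apply measurable_prodMk_left
      (hΦ (measurable_prodMk_left hs))]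
  rfl

theorem isSufficientStatistic_of_indepFun {R : Type*} [MeasurableSpace R]
    [∀ θ, IsProbabilityMeasure (P θ)] {S : Y → R} {ρ : Measure R} [IsProbabilityMeasure ρ]
    {Φ : Z × R → Y} (hT : Measurable T) (hS : Measurable S) (hΦ : Measurable Φ)
    (h_indep : ∀ θ, IndepFun T S (P θ)) (hρ : ∀ θ, (P θ).map S = ρ)
    (h_eq : ∀ y, Φ (T y, S y) = y) : IsSufficientStatistic P T := by
  refine ⟨(Kernel.id ×ₖ Kernel.const Z ρ).map Φ, Kernel.IsMarkovKernel.map _ hΦ, fun θ => ?_⟩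
  have := Measure.isProbabilityMeasure_map (μ := P θ) hT.aemeasurable
  rw [← map_prodMk_fst_prod_eq_compProd _ _ hΦ, ← hρ θ,
    ← (indepFun_iff_map_prod_eq_prod_map_map hT.aemeasurable hS.aemeasurable).mp (h_indep θ),
    Measure.map_map (measurable_fst.prodMk hΦ) (hT.prodMk hS)]
  simp only [Function.comp_def, h_eq]

end LehmannScheffe

section TranslationFamilies

/-- The translation family of `ν` along `g`: the laws of `g θ + ξ`, where `ξ` has law `ν`. -/
noncomputable def translationFamily {Θ Z : Type*} [Add Z] [MeasurableSpace Z] (ν : Measure Z)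
    (g : Θ → Z) (θ : Θ) : Measure Z :=
  ν.map fun z => g θ + z

variable {𝕜 Θ Y Z : Type*} [RCLike 𝕜]

instance isProbabilityMeasure_translationFamily [Add Z] [MeasurableSpace Z] [MeasurableAdd Z]
    (ν : Measure Z) [IsProbabilityMeasure ν] (g : Θ → Z) (θ : Θ) :
    IsProbabilityMeasure (translationFamily ν g θ) :=
  Measure.isProbabilityMeasure_map (by fun_prop)

instance isGaussian_translationFamily [NormedAddCommGroup Z] [NormedSpace ℝ Z] [MeasurableSpace Z]
    [BorelSpace Z] (ν : Measure Z) [IsGaussian ν] (g : Θ → Z) (θ : Θ) :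
    IsGaussian (translationFamily ν g θ) := by
  unfold translationFamily
  infer_instance

theorem isCompleteStatistic_of_map_eq_translationFamily [MeasurableSpace Y] [NormedAddCommGroup Z]
    [NormedSpace ℝ Z] [MeasurableSpace Z] [BorelSpace Z] [SecondCountableTopology Z]
    [CompleteSpace Z] {ν : Measure Z} [IsGaussian ν] (hν : ∫ z, z ∂ν = 0) {P : Θ → Measure Y}
    {g : Θ → Z} (hg : Function.Surjective g) {T : Y → Z} (hT : Measurable T)
    (hP : ∀ θ, (P θ).map T = translationFamily ν g θ) : IsCompleteStatistic 𝕜 P T := by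
  intro f hf hf_int hf_zero θ
  refine ae_of_ae_map (p := fun z => f z = 0) hT.aemeasurable ?_
  rw [hP, translationFamily,
    ae_map_iff (by fun_prop) (measurableSet_eq_fun hf measurable_const)]
  refine ae_eq_zero_of_forall_integral_add_eq_zero (g := fun z => f (g θ + z)) hν
    (by fun_prop) (fun m => ?_) fun m => ?_
  all_goals
    obtain ⟨θ', hθ'⟩ := hg (g θ + m)
    simp only [← add_assoc, ← hθ']
  · have h := hf_int θ'
    change Integrable (f ∘ T) (P θ') at h
    rw [← integrable_map_measure (by fun_prop) (by fun_prop), hP, translationFamily,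
      integrable_map_measure (by fun_prop) (by fun_prop)] at h
    exact h
  · have h := hf_zero θ'
    rw [← integral_map (f := f) (by fun_prop) (by fun_prop), hP, translationFamily,
      integral_map (by fun_prop) (by fun_prop)] at h
    exact h

theorem isUnbiased_of_map_eq_translationFamily [MeasurableSpace Y] {ν : Measure 𝕜}
    [IsProbabilityMeasure ν] (hν_int : Integrable (fun z => z) ν) (hν : ∫ z, z ∂ν = 0)
    {P : Θ → Measure Y} {g : Θ → 𝕜} {T : Y → 𝕜} (hT : Measurable T)
    (hP : ∀ θ, (P θ).map T = translationFamily ν g θ) : IsUnbiased P g T := by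
  refine ⟨hT, fun θ => ⟨?_, ?_⟩⟩
  · rw [← Function.id_comp T, ← integrable_map_measure (by fun_prop) (by fun_prop), hP,
      translationFamily, integrable_map_measure (by fun_prop) (by fun_prop)]
    exact (integrable_const (g θ)).add hν_int
  · rw [← integral_map (f := fun z => z) (by fun_prop) (by fun_prop), hP, translationFamily,
      integral_map (by fun_prop) (by fun_prop), integral_add (integrable_const _) hν_int, hν]
    simp

theorem map_translationFamily [AddCommGroup Y] [Module 𝕜 Y] [TopologicalSpace Y]
    [MeasurableSpace Y] [BorelSpace Y] [ContinuousAdd Y] [AddCommGroup Z] [Module 𝕜 Z]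
    [TopologicalSpace Z] [MeasurableSpace Z] [BorelSpace Z] [ContinuousAdd Z]
    (ρ : Measure Y) (g : Θ → Y) (T : Y →L[𝕜] Z) (θ : Θ) :
    (translationFamily ρ g θ).map T = translationFamily (ρ.map T) (T ∘ g) θ := by
  rw [translationFamily, translationFamily, Measure.map_map (by fun_prop) (by fun_prop),
    Measure.map_map (by fun_prop) (by fun_prop)]
  simp only [Function.comp_def, map_add]

theorem indepFun_map {Ω R : Type*} [MeasurableSpace Ω] [MeasurableSpace Y] [MeasurableSpace Z]
    [MeasurableSpace R] {μ : Measure Ω} {f : Ω → Y} {T : Y → Z} {S : Y → R} (hf : Measurable f)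
    (hT : Measurable T) (hS : Measurable S) (h_indep : IndepFun (T ∘ f) (S ∘ f) μ) :
    IndepFun T S (μ.map f) := by
  rw [indepFun_iff_measure_inter_preimage_eq_mul] at h_indep ⊢
  intro s t hs ht
  rw [Measure.map_apply hf ((hT hs).inter (hS ht)), Measure.map_apply hf (hT hs),
    Measure.map_apply hf (hS ht)]
  exact h_indep s t hs ht

theorem indepFun_translationFamily {R : Type*} [AddCommGroup Y] [Module 𝕜 Y] [TopologicalSpace Y]
    [MeasurableSpace Y] [BorelSpace Y] [ContinuousAdd Y] [AddCommGroup Z] [Module 𝕜 Z]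
    [TopologicalSpace Z] [MeasurableSpace Z] [BorelSpace Z] [ContinuousAdd Z] [AddCommGroup R]
    [Module 𝕜 R] [TopologicalSpace R] [MeasurableSpace R] [BorelSpace R] [ContinuousAdd R]
    {ρ : Measure Y} {T : Y →L[𝕜] Z} {S : Y →L[𝕜] R} (h_indep : IndepFun T S ρ) (g : Θ → Y)
    (θ : Θ) : IndepFun T S (translationFamily ρ g θ) := by
  refine indepFun_map (by fun_prop) (by fun_prop) (by fun_prop) ?_
  simpa only [Function.comp_def, map_add] using
    h_indep.comp (φ := (T (g θ) + ·)) (ψ := (S (g θ) + ·)) (by fun_prop) (by fun_prop)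

end TranslationFamilies

section LinearModels

variable {𝕜 E : Type*} [RCLike 𝕜] [AddCommGroup E] [Module 𝕜 E]

section Nuisance

variable (ψ : E →ₗ[𝕜] 𝕜) {v : E} (hv : ψ v = 1)

/-- The component of `x` in `ker ψ` along `v`. -/
def nuisance : E →ₗ[𝕜] LinearMap.ker ψ :=
  LinearMap.codRestrict _ (LinearMap.id - ψ.smulRight v) fun x => by simp [hv]

theorem coe_nuisance (x : E) : (nuisance ψ hv x : E) = x - ψ x • v := rfl

theorem bijective_prodMk_nuisance : Function.Bijective fun x => (ψ x, nuisance ψ hv x) := by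
  refine Function.bijective_iff_has_inverse.mpr ⟨fun p => p.2 + p.1 • v, fun x => ?_, fun p => ?_⟩
  · simp [coe_nuisance]
  · have h_ker : ψ p.2 = 0 := p.2.2
    ext <;> simp [coe_nuisance, hv, h_ker]

end Nuisance

variable {Y : Type*} [NormedAddCommGroup Y] [NormedSpace 𝕜 Y]

/-- What remains of `y` once `T y • u` is removed: when `T u = 1`, the component of `y` in `ker T`
along `u`. -/
def residual (T : Y →L[𝕜] 𝕜) (u : Y) : Y →L[𝕜] Y :=
  ContinuousLinearMap.id 𝕜 Y - T.smulRight u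

theorem residual_apply (T : Y →L[𝕜] 𝕜) (u y : Y) : residual T u y = y - T y • u := rfl

variable [MeasurableSpace Y] [BorelSpace Y] {ρ : Measure Y} {B : E →ₗ[𝕜] Y} {T : Y →L[𝕜] 𝕜}
  {v : E}

theorem isSufficientStatistic_translationFamily_fiber [SecondCountableTopology Y]
    [IsProbabilityMeasure ρ] (hv : (T.toLinearMap ∘ₗ B) v = 1)
    (h_indep : IndepFun T (residual T (B v)) ρ)
    (h : LinearMap.ker (T.toLinearMap ∘ₗ B)) :
    IsSufficientStatistic
      (fun x : {x // nuisance (T.toLinearMap ∘ₗ B) hv x = h} => translationFamily ρ B x) T := by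
  have := Measure.isProbabilityMeasure_map (μ := ρ) (f := residual T (B v)) (by fun_prop)
  refine isSufficientStatistic_of_indepFun (S := residual T (B v))
    (ρ := translationFamily (ρ.map (residual T (B v))) (fun _ : Unit => B h) ())
    (Φ := fun p => p.2 + p.1 • B v)
    (by fun_prop) (by fun_prop) (by fun_prop) (fun x => indepFun_translationFamily h_indep _ _)
    ?_ (fun y => by simp [residual_apply])
  rintro ⟨x, rfl⟩
  rw [map_translationFamily, translationFamily, translationFamily]
  simp [residual_apply, coe_nuisance]

theorem isSufficientFor_translationFamily [SecondCountableTopology Y]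
    [IsProbabilityMeasure ρ] (hv : (T.toLinearMap ∘ₗ B) v = 1)
    (h_indep : IndepFun T (residual T (B v)) ρ) :
    IsSufficientFor (translationFamily ρ B) (T.toLinearMap ∘ₗ B) T := by
  refine ⟨fun x x' hx => ?_, nuisance _ hv, bijective_prodMk_nuisance _ hv,
    isSufficientStatistic_translationFamily_fiber hv h_indep⟩
  rw [map_translationFamily, map_translationFamily, translationFamily, translationFamily]
  exact congrArg (fun t => (ρ.map T).map (t + ·)) hx

variable [NormedSpace ℝ Y] [IsScalarTower ℝ 𝕜 Y] [IsGaussian ρ]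

theorem isCompleteStatistic_translationFamily (hT : ∫ y, T y ∂ρ = 0) {Θ : Type*} {g : Θ → Y}
    (hg : Function.Surjective (T ∘ g)) : IsCompleteStatistic 𝕜 (translationFamily ρ g) T := by
  have : IsGaussian (ρ.map T) := isGaussian_map (T.restrictScalars ℝ)
  refine isCompleteStatistic_of_map_eq_translationFamily ?_ hg (by fun_prop)
    (map_translationFamily ρ g T)
  rwa [integral_map (by fun_prop) (by fun_prop)]

theorem isUnbiased_translationFamily (hT : ∫ y, T y ∂ρ = 0) {Θ : Type*} (g : Θ → Y) :
    IsUnbiased (translationFamily ρ g) (T ∘ g) T := by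
  have : IsGaussian (ρ.map T) := isGaussian_map (T.restrictScalars ℝ)
  refine isUnbiased_of_map_eq_translationFamily
    (IsGaussian.memLp_two_id.integrable one_le_two) ?_ (by fun_prop) (map_translationFamily ρ g T)
  rwa [integral_map (by fun_prop) (by fun_prop)]

variable [SecondCountableTopology Y]

theorem isMVUE_translationFamily (hT : ∫ y, T y ∂ρ = 0) (hv : (T.toLinearMap ∘ₗ B) v = 1)
    (h_indep : IndepFun T (residual T (B v)) ρ) :
    IsMVUE (translationFamily ρ B) (T.toLinearMap ∘ₗ B) T := by
  have hU : IsUnbiased (translationFamily ρ B) (T.toLinearMap ∘ₗ B) T :=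
    isUnbiased_translationFamily hT B
  refine isMVUE_of_forall_fiber (η := nuisance _ hv) hU fun h => ?_
  have h_surj : Function.Surjective
      (T ∘ fun x : {x // nuisance (T.toLinearMap ∘ₗ B) hv x = h} => B x) := fun t => by
    obtain ⟨x, hx⟩ := (bijective_prodMk_nuisance _ hv).surjective (t, h)
    exact ⟨⟨x, congrArg Prod.snd hx⟩, congrArg Prod.fst hx⟩
  exact isMVUE_of_isCompleteStatistic_of_isSufficientStatistic (φ := id) (by fun_prop)
    measurable_id (isCompleteStatistic_translationFamily hT h_surj)
    (isSufficientStatistic_translationFamily_fiber hv h_indep h) (hU.comp _)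

theorem eVar_translationFamily_ne_top [CompleteSpace Y] (T : Y →L[𝕜] 𝕜) {Θ : Type*} (g : Θ → Y)
    (θ : Θ) : eVar T (translationFamily ρ g θ) ≠ ∞ :=
  eVar_ne_top_of_memLp ((T.restrictScalars ℝ).comp_memLp' IsGaussian.memLp_two_id)

end LinearModels

section RegressionModel

variable {𝕜 : Type*} [RCLike 𝕜] {N n : ℕ} {A : Matrix (Fin N) (Fin n) 𝕜} {w : Fin n → 𝕜}
  {μ : Measure (Fin N → 𝕜)} {I : Finset (Fin N)} {D : Divisor A w}

variable (𝕜 I) in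
/-- The passage from a vector `b` to its subvector `b_I`. -/
def restrictCLM : (Fin N → 𝕜) →L[𝕜] (I → 𝕜) :=
  (LinearMap.funLeft 𝕜 𝕜 Subtype.val).toContinuousLinearMap

variable (I D) in
/-- The estimator `b_I ↦ ⟨λ_D, b⟩` as a continuous linear map. -/
noncomputable def estimatorCLM : (I → 𝕜) →L[𝕜] 𝕜 :=
  (dotProductBilin 𝕜 𝕜 fun i : I => divisorVector D i).toContinuousLinearMap

theorem coe_estimatorCLM : ⇑(estimatorCLM I D) = estimator I D := rfl

theorem observationLaw_eq_translationFamily (A : Matrix (Fin N) (Fin n) 𝕜)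
    (μ : Measure (Fin N → 𝕜)) (I : Finset (Fin N)) :
    observationLaw A μ I = translationFamily (μ.map (restrictCLM 𝕜 I))
      ((restrictCLM 𝕜 I).toLinearMap ∘ₗ A.mulVecLin) := by
  funext x
  rw [translationFamily, Measure.map_map (by fun_prop) (by fun_prop)]
  rfl

theorem estimatorCLM_restrictCLM (hD : divisorVector D ∈ representationsOn A w I) (e : Fin N → 𝕜) :
    estimatorCLM I D (restrictCLM 𝕜 I e) = divisorVector D ⬝ᵥ e := by
  calc _ = ∑ i ∈ I, divisorVector D i * e i :=
        Finset.sum_coe_sort I fun i => divisorVector D i * e i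
    _ = divisorVector D ⬝ᵥ e :=
        Finset.sum_subset I.subset_univ fun i _ hi => by rw [hD.1 i hi, zero_mul]

theorem estimatorCLM_comp_eq_target (hD : divisorVector D ∈ representationsOn A w I) :
    (estimatorCLM I D).toLinearMap ∘ₗ (restrictCLM 𝕜 I).toLinearMap ∘ₗ A.mulVecLin = target w := by
  refine LinearMap.ext fun x => ?_
  calc _ = divisorVector D ⬝ᵥ A *ᵥ x := estimatorCLM_restrictCLM hD _
    _ = w ⬝ᵥ x := by rw [Matrix.dotProduct_mulVec, hD.2]

theorem integral_estimatorCLM (hμ : IsGaussianNoise μ)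
    (hD : divisorVector D ∈ representationsOn A w I) :
    ∫ b, estimatorCLM I D b ∂(μ.map (restrictCLM 𝕜 I)) = 0 := by
  rw [integral_map (by fun_prop) (by fun_prop)]
  simp only [estimatorCLM_restrictCLM hD, hμ.integral_dotProduct]

theorem indepFun_estimatorCLM_residual (hμ : IsGaussianNoise μ)
    (hD : divisorVector D ∈ representationsOn A w I) {v : Fin n → 𝕜}
    (hv : ∀ i ∈ I, (star (divisorVector D) ᵥ* noiseCov μ) i =
      (A *ᵥ v) i * (star (divisorVector D) ⬝ᵥ noiseCov μ *ᵥ divisorVector D)) :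
    IndepFun (estimatorCLM I D) (residual (estimatorCLM I D) (restrictCLM 𝕜 I (A *ᵥ v)))
      (μ.map (restrictCLM 𝕜 I)) := by
  have h_covVar : restrictCLM 𝕜 I (star (divisorVector D) ᵥ* noiseCov μ) =
      (star (divisorVector D) ⬝ᵥ noiseCov μ *ᵥ divisorVector D) • restrictCLM 𝕜 I (A *ᵥ v) :=
    funext fun i => (hv i i.2).trans (mul_comm _ _)
  have h_var : estimatorCLM I D (restrictCLM 𝕜 I (star (divisorVector D) ᵥ* noiseCov μ)) =
      star (divisorVector D) ⬝ᵥ noiseCov μ *ᵥ divisorVector D := by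
    rw [estimatorCLM_restrictCLM hD, dotProduct_comm, Matrix.dotProduct_mulVec]
  have h_zero : (residual (estimatorCLM I D) (restrictCLM 𝕜 I (A *ᵥ v)) ∘L restrictCLM 𝕜 I)
      (star (divisorVector D) ᵥ* noiseCov μ) = 0 := by
    rw [ContinuousLinearMap.comp_apply, residual_apply, h_var, h_covVar, sub_self]
  refine indepFun_map (by fun_prop) (by fun_prop) (by fun_prop) ?_
  have h_eq : estimatorCLM I D ∘ restrictCLM 𝕜 I = fun e => divisorVector D ⬝ᵥ e :=
    funext (estimatorCLM_restrictCLM hD)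
  rw [h_eq, ← ContinuousLinearMap.coe_comp]
  exact hμ.indepFun_dotProduct h_zero

end RegressionModel

end MatroidRegression

theorem mainTheorem3_general {𝕜 : Type*} [RCLike 𝕜] {N n : ℕ}
    (A : Matrix (Fin N) (Fin n) 𝕜) (w : Fin n → 𝕜) (hw : w ≠ 0)
    (μ : Measure (Fin N → 𝕜)) (hμ : IsGaussianNoise μ)
    (L : AffineSubspace 𝕜 (Divisor A w)) (hL : (L : Set (Divisor A w)).Nonempty)
    (hLw : (L : Set (Divisor A w)) ⊆ regressionSpace A w)
    (I : Finset (Fin N)) (hI : particularSystemOn A w I ⊆ (L : Set (Divisor A w))) :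
    (∃ D, IsKernelMinimizer (noiseCov μ) L D) ∧
    ∀ D, IsKernelMinimizer (noiseCov μ) L D → (∀ i ∉ I, divisorVector D i = 0) →
      IsCompleteStatistic 𝕜 (observationLaw A μ I) (estimator I D) ∧
      IsSufficientFor (observationLaw A μ I) (target w) (estimator I D) ∧
      IsMVUE (observationLaw A μ I) (target w) (estimator I D) ∧
      ∀ U, IsMVUE (observationLaw A μ I) (target w) U →
        ∀ x, U =ᵐ[observationLaw A μ I x] estimator I D := by
  have hS := hμ.posSemidef_noiseCov
  refine ⟨exists_isKernelMinimizer hS hL, fun D hD hDI => ?_⟩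
  have hDw : divisorVector D ∈ representationsOn A w I :=
    ⟨hDI, (mem_particularSystemOn_iff.mp (hLw hD.1)).2⟩
  obtain ⟨v, hv : target w v = 1, h_cov⟩ := exists_regression_direction hS hw hDw fun z hz =>
    hD.dotProduct_mulVec_eq_zero hS hI hDw hz
  have h_surj : Function.Surjective (target w) := LinearMap.surjective fun h => by simp [h] at hv
  have := hμ.gaussian
  have : IsGaussian (μ.map (restrictCLM 𝕜 I)) :=
    isGaussian_map ((restrictCLM 𝕜 I).restrictScalars ℝ)
  have h_indep := indepFun_estimatorCLM_residual hμ hDw h_cov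
  have h_mean := integral_estimatorCLM hμ hDw
  rw [← coe_estimatorCLM, observationLaw_eq_translationFamily, ← estimatorCLM_comp_eq_target hDw]
  rw [← estimatorCLM_comp_eq_target hDw] at hv h_surj
  have h_mvue := isMVUE_translationFamily h_mean hv h_indep
  exact ⟨isCompleteStatistic_translationFamily h_mean h_surj,
    isSufficientFor_translationFamily hv h_indep, h_mvue, fun U hU x =>
      hU.ae_eq h_mvue (eVar_translationFamily_ne_top _ _ x)⟩

theorem mainTheorem3 {𝕜 : Type*} [RCLike 𝕜] {N n : ℕ}
    (A : Matrix (Fin N) (Fin n) 𝕜) (w : Fin n → 𝕜) (hw : w ≠ 0)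
    (μ : Measure (Fin N → 𝕜)) (hμ : IsGaussianNoise μ)
    (L : AffineSubspace 𝕜 (Divisor A w)) (hL : IsParticularSystem L)
    (I : Finset (Fin N)) (hI : IsSupport L I) :
    (∃ D, IsKernelMinimizer (noiseCov μ) L D) ∧
    ∀ D, IsKernelMinimizer (noiseCov μ) L D → (∀ i ∉ I, divisorVector D i = 0) →
      IsCompleteStatistic 𝕜 (observationLaw A μ I) (estimator I D) ∧
      IsSufficientFor (observationLaw A μ I) (target w) (estimator I D) ∧
      IsMVUE (observationLaw A μ I) (target w) (estimator I D) ∧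
      ∀ U, IsMVUE (observationLaw A μ I) (target w) U →
        ∀ x, U =ᵐ[observationLaw A μ I x] estimator I D :=
  mainTheorem3_general A w hw μ hμ L hL.nonempty hL.subset I hI.prop
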